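/- Let $\Bbbk$ be a field of characteristic $0$ and let $\mathcal G$ be a finite transitive groupoid: finitely many objects $\mathcal G^{(0)}$ and arrows, with an arrow between any two objects. An arrow $g$ has source $s(g)$ and target $t(g)$, and $gh$ is defined when $s(g)=t(h)$. Put $A=\mathrm{Fun}(\mathcal G^{(0)},\Bbbk)$. **Local bisections.** A local bisection of $\mathcal G$ is a pair $(u,X)$ with $X\subseteq\mathcal G^{(0)}$ and $u:X\to\mathcal G$ such that $s\circ u=\mathrm{id}_X$ and $t\circ u$ is injective. The set $\mathcal B(\mathcal G)$ of local bisections is a regular monoid with product $(u,X)\cdot(v,Y)=(uv,Z)$, where $Z=\{y\in Y: t(v(y))\in X\}$ and $(uv)(y)=u(t(v(y)))\,v(y)$; its unit is $(i,\mathcal G^{(0)})$, where $i(x)=\mathrm{id}_x$; the pseudo-inverse is $(u,X)^*=(\bar u,t(u(X)))$, where $\bar u(t(u(x)))=u(x)^{-1}$. (A regular monoid is a monoid with a chosen operation $a\mapsto a^*$ such that $aa^*a=a$ and $a^*aa^*=a^*$; an isomorphism of regular monoids is a bijection preserving products, units and the operations $*$.) **The Hopf algebroid of representative functions.** A representation $\mathcal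 E=(E,\rho)$ of $\mathcal G$ consists of $\Bbbk$-vector spaces $E_x$ $(x\in\mathcal G^{(0)})$, all of the same finite dimension, and linear isomorphisms $\rho_g:E_{s(g)}\to E_{t(g)}$ with $\rho_{\mathrm{id}_x}=\mathrm{id}$ and $\rho_{gh}=\rho_g\rho_h$. A morphism $\lambda:\mathcal E\to\mathcal F$ is a family of linear maps $\lambda_x:E_x\to F_x$ commuting with the $\rho_g$. Let $\Gamma(E)=\prod_xE_x$, $\Gamma(E^*)=\prod_xE_x^*$ and $T_{\mathcal E}=\mathrm{End}(\mathcal E)$. Define $$\mathcal R_\Bbbk(\mathcal G)=\Big(\bigoplus_{\mathcal E}\Gamma(E^*)\otimes_{T_{\mathcal E}}\Gamma(E)\Big)\Big/J ,$$ where $J$ is spanned by all $\varphi\otimes\lambda p-\varphi\lambda\otimes p$ with $\lambda:\mathcal E\to\mathcal F$ a morphism, $\varphi\in\Gamma(F^*)$ and $p\in\Gamma(E)$. It is a commutative Hopf algebroid over $A$ with product $(\varphi\otimes p)(\psi\otimes q)=(\varphi\otimes\psi)\otimes(p\otimes q)$ and unit $1_A\otimes 1_A$ (for the trivial representation), source $\bar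 s(a)=1_A\otimes a$, target $\bar t(a)=a\otimes 1_A$, comultiplication $\Delta(\varphi\otimes p)=\sum_i(\varphi\otimes e_i)\otimes_A(e_i^*\otimes p)$ for fibrewise bases $(e_i)$ with dual bases $(e_i^*)$, counit $\varepsilon(\varphi\otimes p)_x=\varphi(x)(p(x))$, and antipode $S(\varphi\otimes p)=\tilde p\otimes\varphi$ (for the dual representation, where $\tilde p$ is evaluation at $p$). In $\otimes_A$ one identifies $h\,\bar s(a)\otimes h'=h\otimes\bar t(a)h'$. **Local biretractions.** A local biretraction of $\mathcal H=\mathcal R_\Bbbk(\mathcal G)$ is a $\Bbbk$-linear multiplicative map $\alpha:\mathcal H\to A$ (not necessarily unital) such that $\alpha(\bar s(a))=a\,\alpha(1_{\mathcal H})$ for all $a\in A$, and such that there is $e^\alpha\in A$ with $\alpha(\bar t(e^\alpha))=\alpha(1_{\mathcal H})$ for which $\alpha\circ\bar t$ restricts to a bijection $Ae^\alpha\to A\,\alpha(1_{\mathcal H})$. The set $\mathcal Brt(\mathcal H,A)$ of local biretractions is a regular monoid with product $(\alpha*\beta)(h)=\beta(\bar t(\alpha(h_{(1)})))\,\beta(h_{(2)})$,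 unit $\varepsilon$, and pseudo-inverse $\alpha^*=(\alpha\circ\bar t|_{Ae^\alpha})^{-1}\circ\alpha\circ S$. **Statement.** The assignment $(u,X)\mapsto\alpha_{(u,X)}$ with $$\alpha_{(u,X)}(\varphi\otimes p)_x=\begin{cases}\varphi(t(u(x)))\big(\rho_{u(x)}(p(x))\big)& x\in X,\\ 0& x\notin X,\end{cases}$$ is a well-defined isomorphism of regular monoids $\mathcal B(\mathcal G)\to\mathcal Brt(\mathcal R_\Bbbk(\mathcal G),A)$. -/

import Mathlib

open CategoryTheory TensorProduct

noncomputable section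

namespace RepGroupoid

/-! ### Regular monoids -/

/-- A regular monoid: a monoid with a chosen pseudo-inverse `pinv a` of each element `a`. -/
class RegularMonoid (M : Type*) extends Monoid M where
  pinv : M → M
  mul_pinv_mul : ∀ a : M, a * pinv a * a = a
  pinv_mul_pinv : ∀ a : M, pinv a * a * pinv a = pinv a

/-- An isomorphism of regular monoids: a bijection preserving products, units and
pseudo-inverses. -/
structure RegularMonoidIso (M N : Type*) [RegularMonoid M] [RegularMonoid N] where
  toEquiv : M ≃ N
  map_mul : ∀ a b : M, toEquiv (a * b) = toEquiv a * toEquiv b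
  map_one : toEquiv 1 = 1
  map_pinv : ∀ a : M, toEquiv (RegularMonoid.pinv a) = RegularMonoid.pinv (toEquiv a)

/-! ### Local bisections of a groupoid

An arrow `g` with source `x` and target `y` is a morphism `g : x ⟶ y`, and the product `g h` of
two arrows with `s(g) = t(h)` is the composite `h ≫ g`. -/

/-- A local bisection `(u, X)`: `u` maps every `x ∈ X` to an arrow with source `x` (so `s ∘ u = id`
holds by typing), given as a pair of its target and the arrow, and `t ∘ u` is injective on `X`. -/
structure LocalBisection (G : Type*) [Groupoid G] where
  dom : Set G
  u : ∀ x : G, x ∈ dom → Σ y : G, (x ⟶ y)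
  inj : ∀ x (hx : x ∈ dom) y (hy : y ∈ dom), (u x hx).1 = (u y hy).1 → x = y

namespace LocalBisection

variable {G : Type*} [Groupoid G]

theorem eq_of {b c : LocalBisection G} (h : ∀ x, x ∈ b.dom ↔ x ∈ c.dom)
    (h2 : ∀ x (hb : x ∈ b.dom) (hc : x ∈ c.dom), b.u x hb = c.u x hc) : b = c := by
  obtain ⟨X, u, hu⟩ := b
  obtain ⟨Y, v, hv⟩ := c
  obtain rfl : X = Y := Set.ext h
  obtain rfl : u = v := by
    funext x hx
    exact h2 x hx hx
  rfl

theorem u_congr (b : LocalBisection G) {x y : G} (h : x = y) (hx : x ∈ b.dom) (hy : y ∈ b.dom) :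
    (b.u x hx).1 = (b.u y hy).1 := by
  subst h
  rfl

/-- `(u, X) · (v, Y) = (uv, Z)` with `Z = {y ∈ Y | t(v(y)) ∈ X}` and
`(uv)(y) = u(t(v(y))) v(y)`. -/
instance : Mul (LocalBisection G) where
  mul b c :=
    { dom := {y | ∃ hy : y ∈ c.dom, (c.u y hy).1 ∈ b.dom}
      u := fun y h => ⟨(b.u (c.u y h.1).1 h.2).1, (c.u y h.1).2 ≫ (b.u (c.u y h.1).1 h.2).2⟩
      inj := fun x hx y hy h => c.inj x hx.1 y hy.1 (b.inj _ hx.2 _ hy.2 h) }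

/-- The unit `(i, G⁽⁰⁾)`. -/
instance : One (LocalBisection G) where
  one :=
    { dom := Set.univ
      u := fun x _ => ⟨x, 𝟙 x⟩
      inj := fun _ _ _ _ h => h }

theorem exists_inv (b : LocalBisection G) (y : G) (hy : ∃ x, ∃ hx : x ∈ b.dom, (b.u x hx).1 = y) :
    ∃ q : Σ x : G, (y ⟶ x), ∃ hx : q.1 ∈ b.dom, b.u q.1 hx = ⟨y, Groupoid.inv q.2⟩ := by
  obtain ⟨x, hx, rfl⟩ := hy
  exact ⟨⟨x, Groupoid.inv (b.u x hx).2⟩, hx, by simp⟩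

/-- `(u, X)^* = (ū, t(u(X)))` with `ū(t(u(x))) = u(x)⁻¹`; see `inverse_u`. -/
def inverse (b : LocalBisection G) : LocalBisection G where
  dom := {y | ∃ x, ∃ hx : x ∈ b.dom, (b.u x hx).1 = y}
  u := fun y hy => (b.exists_inv y hy).choose
  inj := fun x hx y hy h => by
    obtain ⟨h1, h2⟩ := (b.exists_inv x hx).choose_spec
    obtain ⟨h3, h4⟩ := (b.exists_inv y hy).choose_spec
    have e1 := congrArg Sigma.fst h2
    have e2 := congrArg Sigma.fst h4
    exact e1.symm.trans ((b.u_congr h h1 h3).trans e2)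

theorem inverse_u (b : LocalBisection G) (x : G) (hx : x ∈ b.dom)
    (h : (b.u x hx).1 ∈ b.inverse.dom) :
    b.inverse.u (b.u x hx).1 h = ⟨x, Groupoid.inv (b.u x hx).2⟩ := by
  obtain ⟨h1, h2⟩ := (b.exists_inv _ h).choose_spec
  change (b.exists_inv _ h).choose = _
  generalize (b.exists_inv _ h).choose = q at h1 h2
  obtain ⟨z, g⟩ := q
  obtain rfl : z = x := b.inj _ h1 _ hx (congrArg Sigma.fst h2)
  rw [Sigma.mk.injEq]
  refine ⟨rfl, heq_of_eq ?_⟩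
  have h3 : b.u z h1 = b.u z hx := rfl
  have h4 := h3.symm.trans h2
  rw [Sigma.ext_iff] at h4
  rw [eq_of_heq h4.2]
  simp

theorem mem_mul {b c : LocalBisection G} {x : G} :
    x ∈ (b * c).dom ↔ ∃ hx : x ∈ c.dom, (c.u x hx).1 ∈ b.dom := Iff.rfl

theorem mul_u (b c : LocalBisection G) (x : G) (h : x ∈ (b * c).dom) :
    (b * c).u x h = ⟨(b.u (c.u x h.1).1 h.2).1, (c.u x h.1).2 ≫ (b.u (c.u x h.1).1 h.2).2⟩ := rfl

theorem inverse_mul (b : LocalBisection G) :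
    (∀ x, x ∈ (b.inverse * b).dom ↔ x ∈ b.dom) ∧
      ∀ x h, (b.inverse * b).u x h = ⟨x, 𝟙 x⟩ := by
  refine ⟨fun x => ⟨fun h => h.1, fun h => ⟨h, x, h, rfl⟩⟩, fun x h => ?_⟩
  rw [mul_u, inverse_u]
  simp

instance : RegularMonoid (LocalBisection G) where
  mul_assoc a b c := by
    refine eq_of (fun x => ⟨fun h => ⟨⟨h.1, h.2.1⟩, h.2.2⟩, fun h => ⟨h.1.1, h.1.2, h.2⟩⟩) ?_
    intro x h1 h2
    simp only [mul_u, Category.assoc]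
  one_mul b := by
    refine eq_of (fun x => ⟨fun h => h.1, fun h => ⟨h, trivial⟩⟩) ?_
    intro x h1 h2
    change (⟨(b.u x h2).1, (b.u x h2).2 ≫ 𝟙 _⟩ : Σ y : G, (x ⟶ y)) = _
    simp
  mul_one b := by
    refine eq_of (fun x => ⟨fun h => h.2, fun h => ⟨trivial, h⟩⟩) ?_
    intro x h1 h2
    change (⟨(b.u x h2).1, 𝟙 _ ≫ (b.u x h2).2⟩ : Σ y : G, (x ⟶ y)) = _
    simp
  pinv := inverse
  mul_pinv_mul b := by
    rw [show b * b.inverse * b = b * (b.inverse * b) from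
      eq_of (fun x => ⟨fun h => ⟨⟨h.1, h.2.1⟩, h.2.2⟩, fun h => ⟨h.1.1, h.1.2, h.2⟩⟩)
        (fun x h1 h2 => by simp only [mul_u, Category.assoc])]
    obtain ⟨h1, h2⟩ := b.inverse_mul
    refine eq_of (fun x => ⟨fun h => (h1 x).1 h.1, fun h => ⟨(h1 x).2 h, ?_⟩⟩) ?_
    · rw [h2]
      exact h
    · intro x hx hb
      rw [mul_u]
      have := h2 x hx.1
      generalize_proofs p q at *
      revert q
      rw [this]
      intro q
      simp
  pinv_mul_pinv b := by
    obtain ⟨h1, h2⟩ := b.inverse_mul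
    refine eq_of (fun y => ⟨fun h => h.1, ?_⟩) ?_
    · rintro ⟨x, hx, rfl⟩
      have hm : (b.u x hx).1 ∈ b.inverse.dom := ⟨x, hx, rfl⟩
      refine ⟨hm, ?_⟩
      rw [inverse_u]
      exact (h1 x).2 hx
    · rintro y hy ⟨x, hx, rfl⟩
      rw [mul_u]
      have := b.inverse_u x hx ⟨x, hx, rfl⟩
      generalize_proofs p q at *
      revert q
      rw [this]
      intro q
      rw [h2]
      simp

end LocalBisection

/-! ### Commutative Hopf algebroids -/

section HopfAlgebroid

variable {k A H B : Type*} [Field k] [CommRing A] [Algebra k A] [CommRing H] [Algebra k H]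
  [CommRing B] [Algebra k B]

/-- The ideal of `H ⊗[k] H` generated by all `s(a) ⊗ 1 - 1 ⊗ t(a)`. -/
def balIdeal (s t : A →ₐ[k] H) : Ideal (H ⊗[k] H) :=
  Ideal.span (Set.range fun a : A => s a ⊗ₜ[k] (1 : H) - (1 : H) ⊗ₜ[k] t a)

/-- The algebra `H ⊗_A H`, where the left factor is an `A`-module through `s` and the right factor
is an `A`-module through `t` (so `h s(a) ⊗ h' = h ⊗ t(a) h'`). -/
def BalTensor (s t : A →ₐ[k] H) : Type _ := (H ⊗[k] H) ⧸ balIdeal s t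

namespace BalTensor

variable (s t : A →ₐ[k] H)

instance : CommRing (BalTensor s t) :=
  inferInstanceAs (CommRing ((H ⊗[k] H) ⧸ balIdeal s t))

instance : Algebra k (BalTensor s t) :=
  inferInstanceAs (Algebra k ((H ⊗[k] H) ⧸ balIdeal s t))

/-- The quotient map. -/
def mk : H ⊗[k] H →ₐ[k] BalTensor s t := Ideal.Quotient.mkₐ k (balIdeal s t)

/-- `h ↦ h ⊗ 1` -/
def inl : H →ₐ[k] BalTensor s t :=
  (mk s t).comp Algebra.TensorProduct.includeLeft

/-- `h ↦ 1 ⊗ h` -/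
def inr : H →ₐ[k] BalTensor s t :=
  (mk s t).comp Algebra.TensorProduct.includeRight

theorem inl_src (a : A) : inl s t (s a) = inr s t (t a) := by
  exact (Ideal.Quotient.eq).2 (Ideal.subset_span ⟨a, rfl⟩)

variable {s t}

@[elab_as_elim]
theorem induction {P : BalTensor s t → Prop} (z : BalTensor s t)
    (tmul : ∀ x y, P (inl s t x * inr s t y)) (zero : P 0)
    (add : ∀ z w, P z → P w → P (z + w)) : P z := by
  obtain ⟨z, rfl⟩ : ∃ w, mk s t w = z := Ideal.Quotient.mk_surjective z
  induction z using TensorProduct.induction_on with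
  | zero => simpa using zero
  | tmul x y =>
    convert tmul x y using 1
    simp [inl, inr, ← map_mul]
  | add x y hx hy =>
    rw [map_add]
    exact add _ _ hx hy

/-- The algebra map `x ⊗ y ↦ f(x) g(y)`. -/
def lift (f g : H →ₐ[k] B) (h : ∀ a, f (s a) = g (t a)) : BalTensor s t →ₐ[k] B :=
  Ideal.Quotient.liftₐ (balIdeal s t) (Algebra.TensorProduct.productMap f g) (by
    intro x hx
    change x ∈ RingHom.ker (Algebra.TensorProduct.productMap f g)
    revert x
    change balIdeal s t ≤ _
    rw [balIdeal, Ideal.span_le]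
    rintro _ ⟨a, rfl⟩
    simp [RingHom.mem_ker, h])

@[simp] theorem lift_inl (f g : H →ₐ[k] B) (h : ∀ a, f (s a) = g (t a)) (x : H) :
    lift f g h (inl s t x) = f x := by
  change Algebra.TensorProduct.productMap f g (x ⊗ₜ[k] 1) = f x
  simp

@[simp] theorem lift_inr (f g : H →ₐ[k] B) (h : ∀ a, f (s a) = g (t a)) (x : H) :
    lift f g h (inr s t x) = g x := by
  change Algebra.TensorProduct.productMap f g (1 ⊗ₜ[k] x) = g x
  simp

theorem lift_tmul (f g : H →ₐ[k] B) (h : ∀ a, f (s a) = g (t a)) (x y : H) :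
    lift f g h (inl s t x * inr s t y) = f x * g y := by
  rw [map_mul, lift_inl, lift_inr]

/-- The linear map `x ⊗ y ↦ F x y` for a bilinear `F` with `F (x s(a)) y = F x (t(a) y)`. -/
def linLift {M : Type*} [AddCommGroup M] [Module k M] (F : H →ₗ[k] H →ₗ[k] M)
    (h : ∀ a x y, F (x * s a) y = F x (t a * y)) : BalTensor s t →ₗ[k] M :=
  show ((H ⊗[k] H) ⧸ balIdeal s t) →ₗ[k] M from
  (((balIdeal s t).restrictScalars k).liftQ (TensorProduct.lift F) (by
    intro z hz
    rw [LinearMap.mem_ker]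
    suffices key : ∀ w, TensorProduct.lift F (w * z) = 0 by simpa using key 1
    change z ∈ balIdeal s t at hz
    induction hz using Submodule.span_induction with
    | zero => simp
    | add x y _ _ hx hy => intro w; rw [mul_add, map_add, hx, hy, add_zero]
    | mem z hz =>
      obtain ⟨a, rfl⟩ := hz
      intro w
      induction w using TensorProduct.induction_on with
      | zero => simp
      | tmul x y => simp [mul_sub, h, mul_comm y]
      | add x y hx hy => rw [add_mul, map_add, hx, hy, add_zero]
    | smul c z _ hz =>
      intro w
      rw [smul_eq_mul, ← mul_assoc]
      exact hz _)) ∘ₗ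
    ((Submodule.Quotient.restrictScalarsEquiv k (balIdeal s t)).symm : _ →ₗ[k] _)

@[simp] theorem linLift_apply {M : Type*} [AddCommGroup M] [Module k M] (F : H →ₗ[k] H →ₗ[k] M)
    (h : ∀ a x y, F (x * s a) y = F x (t a * y)) (x y : H) :
    linLift F h (inl s t x * inr s t y) = F x y := by
  have : inl s t x * inr s t y = mk s t (x ⊗ₜ[k] y) := by simp [inl, inr, ← map_mul]
  rw [this]
  change TensorProduct.lift F (x ⊗ₜ[k] y) = _
  simp

end BalTensor

/-- The ideal of `H ⊗[k] (H ⊗[k] H)` defining `H ⊗_A H ⊗_A H`. -/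
def balIdeal₃ (s t : A →ₐ[k] H) : Ideal (H ⊗[k] (H ⊗[k] H)) :=
  Ideal.span
    ((Set.range fun a : A => s a ⊗ₜ[k] (1 : H ⊗[k] H) - (1 : H) ⊗ₜ[k] (t a ⊗ₜ[k] (1 : H))) ∪
     (Set.range fun a : A => (1 : H) ⊗ₜ[k] (s a ⊗ₜ[k] (1 : H)) - (1 : H) ⊗ₜ[k] ((1 : H) ⊗ₜ[k] t a)))

/-- The algebra `H ⊗_A H ⊗_A H`. -/
def BalTensor₃ (s t : A →ₐ[k] H) : Type _ := (H ⊗[k] (H ⊗[k] H)) ⧸ balIdeal₃ s t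

namespace BalTensor₃

variable (s t : A →ₐ[k] H)

instance : CommRing (BalTensor₃ s t) :=
  inferInstanceAs (CommRing ((H ⊗[k] (H ⊗[k] H)) ⧸ balIdeal₃ s t))

instance : Algebra k (BalTensor₃ s t) :=
  inferInstanceAs (Algebra k ((H ⊗[k] (H ⊗[k] H)) ⧸ balIdeal₃ s t))

/-- The quotient map. -/
def mk : H ⊗[k] (H ⊗[k] H) →ₐ[k] BalTensor₃ s t := Ideal.Quotient.mkₐ k (balIdeal₃ s t)

/-- `h ↦ h ⊗ 1 ⊗ 1` -/
def in₁ : H →ₐ[k] BalTensor₃ s t :=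
  (mk s t).comp Algebra.TensorProduct.includeLeft

/-- `h ↦ 1 ⊗ h ⊗ 1` -/
def in₂ : H →ₐ[k] BalTensor₃ s t :=
  (mk s t).comp
    ((Algebra.TensorProduct.includeRight).comp Algebra.TensorProduct.includeLeft)

/-- `h ↦ 1 ⊗ 1 ⊗ h` -/
def in₃ : H →ₐ[k] BalTensor₃ s t :=
  (mk s t).comp
    ((Algebra.TensorProduct.includeRight).comp Algebra.TensorProduct.includeRight)

theorem in₁_src (a : A) : in₁ s t (s a) = in₂ s t (t a) :=
  (Ideal.Quotient.eq).2 (Ideal.subset_span (Or.inl ⟨a, rfl⟩))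

theorem in₂_src (a : A) : in₂ s t (s a) = in₃ s t (t a) :=
  (Ideal.Quotient.eq).2 (Ideal.subset_span (Or.inr ⟨a, rfl⟩))

/-- `x ⊗ y ↦ x ⊗ y ⊗ 1` -/
def in₁₂ : BalTensor s t →ₐ[k] BalTensor₃ s t :=
  BalTensor.lift (in₁ s t) (in₂ s t) (in₁_src s t)

/-- `x ⊗ y ↦ 1 ⊗ x ⊗ y` -/
def in₂₃ : BalTensor s t →ₐ[k] BalTensor₃ s t :=
  BalTensor.lift (in₂ s t) (in₃ s t) (in₂_src s t)

/-- The linear map `x ⊗ w ↦ F x w` for a bilinear `F` on `H × (H ⊗_A H)` with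
`F (x s(a)) w = F x ((t(a) ⊗ 1) w)`. -/
def linLift {M : Type*} [AddCommGroup M] [Module k M] (F : H →ₗ[k] BalTensor s t →ₗ[k] M)
    (h : ∀ a x w, F (x * s a) w = F x (BalTensor.inl s t (t a) * w)) : BalTensor₃ s t →ₗ[k] M :=
  show ((H ⊗[k] (H ⊗[k] H)) ⧸ balIdeal₃ s t) →ₗ[k] M from
  (((balIdeal₃ s t).restrictScalars k).liftQ
    (TensorProduct.lift (F.compl₂ (BalTensor.mk s t).toLinearMap)) (by
    intro z hz
    rw [LinearMap.mem_ker]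
    suffices key : ∀ w, TensorProduct.lift (F.compl₂ (BalTensor.mk s t).toLinearMap) (w * z) = 0 by
      simpa using key 1
    change z ∈ balIdeal₃ s t at hz
    induction hz using Submodule.span_induction with
    | zero => simp
    | add x y _ _ hx hy => intro w; rw [mul_add, map_add, hx, hy, add_zero]
    | mem z hz =>
      intro w
      induction w using TensorProduct.induction_on with
      | zero => simp
      | tmul x y =>
        rcases hz with ⟨a, rfl⟩ | ⟨a, rfl⟩
        · have := h a x (BalTensor.mk s t y)
          simp [mul_sub, this, BalTensor.inl, ← map_mul, mul_comm y]
        · have e : BalTensor.mk s t (s a ⊗ₜ[k] 1) = BalTensor.mk s t (1 ⊗ₜ[k] t a) :=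
            BalTensor.inl_src s t a
          simp [mul_sub, e]
      | add x y hx hy => rw [add_mul, map_add, hx, hy, add_zero]
    | smul c z _ hz =>
      intro w
      rw [smul_eq_mul, ← mul_assoc]
      exact hz _)) ∘ₗ
    ((Submodule.Quotient.restrictScalarsEquiv k (balIdeal₃ s t)).symm : _ →ₗ[k] _)

variable {s t} in
theorem linLift_apply {M : Type*} [AddCommGroup M] [Module k M] (F : H →ₗ[k] BalTensor s t →ₗ[k] M)
    (h : ∀ a x w, F (x * s a) w = F x (BalTensor.inl s t (t a) * w)) (x y z : H) :
    linLift s t F h (in₁ s t x * in₂ s t y * in₃ s t z) =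
      F x (BalTensor.inl s t y * BalTensor.inr s t z) := by
  have e1 : in₁ s t x * in₂ s t y * in₃ s t z = mk s t (x ⊗ₜ[k] (y ⊗ₜ[k] z)) := by
    simp [in₁, in₂, in₃, ← map_mul]
  have e2 : BalTensor.inl s t y * BalTensor.inr s t z = BalTensor.mk s t (y ⊗ₜ[k] z) := by
    simp [BalTensor.inl, BalTensor.inr, ← map_mul]
  rw [e1, e2]
  change TensorProduct.lift (F.compl₂ (BalTensor.mk s t).toLinearMap) (x ⊗ₜ[k] (y ⊗ₜ[k] z)) = _
  simp

theorem in₁₂_inl (x : H) : in₁₂ s t (BalTensor.inl s t x) = in₁ s t x := BalTensor.lift_inl _ _ _ x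
theorem in₁₂_inr (x : H) : in₁₂ s t (BalTensor.inr s t x) = in₂ s t x := BalTensor.lift_inr _ _ _ x
theorem in₂₃_inl (x : H) : in₂₃ s t (BalTensor.inl s t x) = in₂ s t x := BalTensor.lift_inl _ _ _ x
theorem in₂₃_inr (x : H) : in₂₃ s t (BalTensor.inr s t x) = in₃ s t x := BalTensor.lift_inr _ _ _ x

end BalTensor₃

variable (k A H) in
/-- A commutative Hopf algebroid `H` over the commutative algebra `A`, with source `s`, target `t`,
comultiplication `Δ`, counit `ε` and antipode `S`; the `A`-bimodule structure of `H` is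
`a · h · b = t(a) s(b) h`. -/
structure CommHopfAlgebroid where
  s : A →ₐ[k] H
  t : A →ₐ[k] H
  Δ : H →ₐ[k] BalTensor s t
  ε : H →ₐ[k] A
  S : H →ₐ[k] H
  Δ_t : ∀ a, Δ (t a) = BalTensor.inl s t (t a)
  Δ_s : ∀ a, Δ (s a) = BalTensor.inr s t (s a)
  ε_t : ∀ a, ε (t a) = a
  ε_s : ∀ a, ε (s a) = a
  /-- `(Δ ⊗ id) ∘ Δ = (id ⊗ Δ) ∘ Δ` -/
  coassoc : ∀ h,
    BalTensor.lift ((BalTensor₃.in₁₂ s t).comp Δ) (BalTensor₃.in₃ s t)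
      (fun a => by rw [AlgHom.comp_apply, Δ_s, BalTensor₃.in₁₂_inr, BalTensor₃.in₂_src]) (Δ h) =
    BalTensor.lift (BalTensor₃.in₁ s t) ((BalTensor₃.in₂₃ s t).comp Δ)
      (fun a => by rw [AlgHom.comp_apply, Δ_t, BalTensor₃.in₂₃_inl, BalTensor₃.in₁_src]) (Δ h)
  /-- `t(ε(h₁)) h₂ = h` -/
  ε_left : ∀ h, BalTensor.lift (t.comp ε) (AlgHom.id k H)
    (fun a => by rw [AlgHom.comp_apply, ε_s, AlgHom.id_apply]) (Δ h) = h
  /-- `h₁ s(ε(h₂)) = h` -/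
  ε_right : ∀ h, BalTensor.lift (AlgHom.id k H) (s.comp ε)
    (fun a => by rw [AlgHom.comp_apply, ε_t, AlgHom.id_apply]) (Δ h) = h
  S_s : ∀ a, S (s a) = t a
  S_t : ∀ a, S (t a) = s a
  /-- `S(h₁) h₂ = s(ε(h))` -/
  S_left : ∀ h, BalTensor.lift S (AlgHom.id k H) (fun a => by rw [S_s, AlgHom.id_apply]) (Δ h) = s (ε h)
  /-- `h₁ S(h₂) = t(ε(h))` -/
  S_right : ∀ h, BalTensor.lift (AlgHom.id k H) S (fun a => by rw [S_t, AlgHom.id_apply]) (Δ h) = t (ε h)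

/-! ### Local biretractions -/

/-- A local biretraction of a commutative Hopf algebroid: a linear multiplicative (not necessarily
unital) map `α : H → A` satisfying (BRT1) and (BRT2). -/
structure Biretraction (ℋ : CommHopfAlgebroid k A H) where
  toMap : H →ₙₐ[k] A
  brt1 : ∀ a, toMap (ℋ.s a) = a * toMap 1
  brt2 : ∃ e : A, toMap (ℋ.t e) = toMap 1 ∧
    Set.BijOn (fun a => toMap (ℋ.t a)) (Ideal.span {e} : Ideal A) (Ideal.span {toMap 1} : Ideal A)

namespace Biretraction

variable {ℋ : CommHopfAlgebroid k A H}

instance : CoeFun (Biretraction ℋ) (fun _ => H → A) := ⟨fun α => α.toMap⟩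

theorem ext' {α β : Biretraction ℋ} (h : ∀ x, α x = β x) : α = β := by
  obtain ⟨f, _, _⟩ := α
  obtain ⟨g, _, _⟩ := β
  obtain rfl : f = g := NonUnitalAlgHom.ext h
  rfl

section basic

variable (α : Biretraction ℋ)

theorem mul' (x y : H) : α (x * y) = α x * α y := map_mul α.toMap x y
theorem add' (x y : H) : α (x + y) = α x + α y := map_add α.toMap x y
theorem sub' (x y : H) : α (x - y) = α x - α y := map_sub α.toMap x y
theorem zero' : α 0 = 0 := map_zero α.toMap
theorem smul' (c : k) (y : H) : α (c • y) = c • α y := map_smul α.toMap c y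
theorem s' (a : A) : α (ℋ.s a) = a * α 1 := α.brt1 a
theorem mul_one' (x : H) : α x * α 1 = α x := by rw [← mul', mul_one]
theorem one_mul' (x : H) : α 1 * α x = α x := by rw [← mul', one_mul]

/-- The element `e^α` of (BRT2). -/
def e : A := α.brt2.choose

theorem t_e : α (ℋ.t α.e) = α 1 := α.brt2.choose_spec.1

theorem bijOn : Set.BijOn (fun a => α (ℋ.t a)) (Ideal.span {α.e} : Ideal A)
    (Ideal.span {α 1} : Ideal A) := α.brt2.choose_spec.2

theorem inj {a b : A} (ha : a ∈ Ideal.span {α.e}) (hb : b ∈ Ideal.span {α.e})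
    (h : α (ℋ.t a) = α (ℋ.t b)) : a = b := α.bijOn.injOn ha hb h

theorem e_mem : α.e ∈ Ideal.span {α.e} := Ideal.subset_span rfl

theorem e_idem : α.e * α.e = α.e := by
  refine α.inj (Ideal.mul_mem_left _ _ α.e_mem) α.e_mem ?_
  rw [map_mul, mul', t_e, mul_one']

theorem mem_e {a : A} : a ∈ Ideal.span {α.e} ↔ a * α.e = a := by
  rw [Ideal.mem_span_singleton']
  exact ⟨by rintro ⟨b, rfl⟩; rw [mul_assoc, e_idem], fun h => ⟨a, h⟩⟩

theorem mem_one {a : A} : a ∈ Ideal.span {α 1} ↔ a * α 1 = a := by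
  rw [Ideal.mem_span_singleton']
  exact ⟨by rintro ⟨b, rfl⟩; rw [mul_assoc, mul_one'], fun h => ⟨a, h⟩⟩

theorem exists_inv (h : H) : ∃ b, b ∈ Ideal.span {α.e} ∧ α (ℋ.t b) = α h :=
  α.bijOn.surjOn (α.mem_one.2 (α.mul_one' h))

/-- The map `(α ∘ t)⁻¹ ∘ α : H → A α(1) → A e^α`. -/
def tinv (h : H) : A := (α.exists_inv h).choose

theorem tinv_mem (h : H) : α.tinv h * α.e = α.tinv h := α.mem_e.1 (α.exists_inv h).choose_spec.1

theorem t_tinv (h : H) : α (ℋ.t (α.tinv h)) = α h := (α.exists_inv h).choose_spec.2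

theorem tinv_eq {h : H} {b : A} (hb : b * α.e = b) (h1 : α (ℋ.t b) = α h) : α.tinv h = b :=
  α.inj (α.mem_e.2 (α.tinv_mem h)) (α.mem_e.2 hb) (by rw [t_tinv, h1])

theorem tinv_t (a : A) : α.tinv (ℋ.t a) = a * α.e :=
  α.tinv_eq (by rw [mul_assoc, e_idem]) (by rw [map_mul, mul', t_e, mul_one'])

theorem tinv_one : α.tinv 1 = α.e := α.tinv_eq α.e_idem α.t_e

theorem tinv_mul (x y : H) : α.tinv (x * y) = α.tinv x * α.tinv y :=
  α.tinv_eq (by rw [mul_assoc, tinv_mem]) (by rw [map_mul, mul', mul', t_tinv, t_tinv])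

theorem tinv_congr {x y : H} (h : α x = α y) : α.tinv x = α.tinv y :=
  α.tinv_eq (α.tinv_mem y) (by rw [t_tinv, h])

/-- The pseudo-inverse `α^* = (α ∘ t)⁻¹ ∘ α ∘ S`. -/
def pinv : Biretraction ℋ where
  toMap :=
    { toFun := fun h => α.tinv (ℋ.S h)
      map_smul' := fun c h => α.tinv_eq (by simp [tinv_mem]) (by
        simp [t_tinv])
      map_zero' := α.tinv_eq (by simp) (by simp)
      map_add' := fun x y => α.tinv_eq (by simp [add_mul, tinv_mem]) (by
        simp [add', t_tinv])
      map_mul' := fun x y => by rw [map_mul, tinv_mul] }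
  brt1 a := by
    change α.tinv (ℋ.S (ℋ.s a)) = a * α.tinv (ℋ.S 1)
    rw [ℋ.S_s, tinv_t, map_one, tinv_one]
  brt2 := by
    change ∃ e : A, α.tinv (ℋ.S (ℋ.t e)) = α.tinv (ℋ.S 1) ∧
      Set.BijOn (fun a => α.tinv (ℋ.S (ℋ.t a))) (Ideal.span {e} : Ideal A)
        (Ideal.span {α.tinv (ℋ.S 1)} : Ideal A)
    simp only [ℋ.S_t, map_one, tinv_one]
    refine ⟨α 1, ?_, ?_, ?_, ?_⟩
    · rw [α.tinv_congr (y := 1) (by rw [s', mul_one']), tinv_one]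
    · intro a _
      exact α.mem_e.2 (α.tinv_mem _)
    · intro a ha b hb h
      have := congrArg (fun c => α (ℋ.t c)) h
      simpa [t_tinv, s', α.mem_one.1 ha, α.mem_one.1 hb] using this
    · intro b hb
      refine ⟨α (ℋ.t b), α.mem_one.2 (α.mul_one' _), ?_⟩
      exact α.tinv_eq (α.mem_e.1 hb) (by rw [s', mul_one'])

theorem pinv_apply (h : H) : α.pinv h = α.tinv (ℋ.S h) := rfl

end basic

/-- The linear map `x ⊗ y ↦ β(t(α(x))) β(y)` on `H ⊗_A H`. -/
def convLin (α β : Biretraction ℋ) : BalTensor ℋ.s ℋ.t →ₗ[k] A :=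
  BalTensor.linLift
    (LinearMap.mk₂ k (fun x y => β (ℋ.t (α x)) * β y)
      (fun x x' y => by simp [add', add_mul])
      (fun c x y => by simp)
      (fun x y y' => by simp [add', mul_add])
      (fun c x y => by simp))
    (fun a x y => by
      simp only [LinearMap.mk₂_apply]
      rw [mul', s', mul_left_comm, mul_one', mul', map_mul, mul', mul_left_comm, mul_assoc])

theorem convLin_apply (α β : Biretraction ℋ) (x y : H) :
    convLin α β (BalTensor.inl ℋ.s ℋ.t x * BalTensor.inr ℋ.s ℋ.t y) = β (ℋ.t (α x)) * β y := by
  simp [convLin]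

theorem convLin_inl (α β : Biretraction ℋ) (x : H) :
    convLin α β (BalTensor.inl ℋ.s ℋ.t x) = β (ℋ.t (α x)) := by
  have := convLin_apply α β x 1
  rwa [map_one, mul_one, mul_one'] at this

theorem convLin_inr (α β : Biretraction ℋ) (y : H) :
    convLin α β (BalTensor.inr ℋ.s ℋ.t y) = β (ℋ.t (α 1)) * β y := by
  have := convLin_apply α β 1 y
  rwa [map_one, one_mul] at this

theorem convLin_mul (α β : Biretraction ℋ) (z w : BalTensor ℋ.s ℋ.t) :
    convLin α β (z * w) = convLin α β z * convLin α β w := by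
  induction z using BalTensor.induction with
  | zero => simp
  | add z z' h h' => rw [add_mul, map_add, h, h', map_add, add_mul]
  | tmul x y =>
    induction w using BalTensor.induction with
    | zero => simp
    | add z z' h h' => rw [mul_add, map_add, h, h', map_add, mul_add]
    | tmul x' y' =>
      rw [mul_mul_mul_comm, ← map_mul, ← map_mul, convLin_apply, convLin_apply, convLin_apply,
        mul', mul', map_mul, mul', mul_mul_mul_comm]

/-- The convolution product `(α ∗ β)(h) = β(t(α(h₁))) β(h₂)`. -/
instance : Mul (Biretraction ℋ) where
  mul α β :=
    { toMap :=
        { toFun := fun h => convLin α β (ℋ.Δ h)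
          map_smul' := fun c h => by simp
          map_zero' := by simp
          map_add' := fun x y => by simp
          map_mul' := fun x y => by rw [map_mul, convLin_mul] }
      brt1 := fun a => by
        change convLin α β (ℋ.Δ (ℋ.s a)) = a * convLin α β (ℋ.Δ 1)
        rw [ℋ.Δ_s, convLin_inr, map_one ℋ.Δ, ← map_one (BalTensor.inl ℋ.s ℋ.t), convLin_inl, s',
          mul_left_comm, mul_one']
      brt2 := by
        have h1 : ∀ a, convLin α β (ℋ.Δ (ℋ.t a)) = β (ℋ.t (α (ℋ.t a))) := fun a => by
          rw [ℋ.Δ_t, convLin_inl]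
        have h0 : convLin α β (ℋ.Δ 1) = β (ℋ.t (α 1)) := by
          rw [map_one, ← map_one (BalTensor.inl ℋ.s ℋ.t), convLin_inl]
        change ∃ e : A, convLin α β (ℋ.Δ (ℋ.t e)) = convLin α β (ℋ.Δ 1) ∧
          Set.BijOn (fun a => convLin α β (ℋ.Δ (ℋ.t a))) (Ideal.span {e} : Ideal A)
            (Ideal.span {convLin α β (ℋ.Δ 1)} : Ideal A)
        simp only [h1, h0]
        have hs : ∀ a, α (ℋ.s (a * α 1)) = a * α 1 := fun a => by rw [s', mul_assoc, mul_one']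
        have he : α (ℋ.t (α.tinv (ℋ.s (β.e * α 1)))) = β.e * α 1 := by rw [t_tinv, hs]
        have hβ : ∀ c, β (ℋ.t (c * β.e)) = β (ℋ.t c) := fun c => by
          rw [map_mul, mul', t_e, mul_one']
        refine ⟨α.tinv (ℋ.s (β.e * α 1)), ?_, ?_, ?_, ?_⟩
        · rw [he, mul_comm, hβ]
        · intro a ha
          obtain ⟨b, rfl⟩ := Ideal.mem_span_singleton'.1 ha
          change β (ℋ.t (α (ℋ.t _))) ∈ _
          rw [map_mul, mul', map_mul, mul']
          refine Ideal.mem_span_singleton'.2 ⟨β (ℋ.t (α (ℋ.t b))), ?_⟩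
          rw [he, mul_comm β.e, hβ]
        · intro a ha b hb h
          obtain ⟨a, rfl⟩ := Ideal.mem_span_singleton'.1 ha
          obtain ⟨b, rfl⟩ := Ideal.mem_span_singleton'.1 hb
          have key : ∀ c, α (ℋ.t (c * α.tinv (ℋ.s (β.e * α 1)))) = α (ℋ.t c) * β.e := fun c => by
            rw [map_mul, mul', he, mul_left_comm, mul_one', mul_comm]
          have memα : ∀ c, c * α.tinv (ℋ.s (β.e * α 1)) ∈ Ideal.span {α.e} := fun c =>
            α.mem_e.2 (by rw [mul_assoc, tinv_mem])
          refine α.inj (memα a) (memα b) ?_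
          simp only [key] at h ⊢
          exact β.inj (Ideal.mul_mem_left _ _ β.e_mem) (Ideal.mul_mem_left _ _ β.e_mem) h
        · intro c hc
          obtain ⟨c, rfl⟩ := Ideal.mem_span_singleton'.1 hc
          refine ⟨α.tinv (ℋ.s (β.tinv (ℋ.s c) * α 1)) * α.tinv (ℋ.s (β.e * α 1)),
            Ideal.mul_mem_left _ _ (Ideal.subset_span rfl), ?_⟩
          change β (ℋ.t (α (ℋ.t _))) = _
          rw [map_mul, mul', he, t_tinv, hs, mul_comm β.e, ← mul_assoc, hβ, mul_assoc, mul_one',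
            map_mul, mul', t_tinv, s', mul_assoc, one_mul'] }

theorem mul_apply (α β : Biretraction ℋ) (h : H) : (α * β) h = convLin α β (ℋ.Δ h) := rfl

theorem mul_t (α β : Biretraction ℋ) (a : A) : (α * β) (ℋ.t a) = β (ℋ.t (α (ℋ.t a))) := by
  rw [mul_apply, ℋ.Δ_t, convLin_inl]

/-- The unit of the convolution product is the counit. -/
instance : One (Biretraction ℋ) where
  one :=
    { toMap := (ℋ.ε : H →ₙₐ[k] A)
      brt1 := fun a => by
        change ℋ.ε _ = a * ℋ.ε 1
        rw [ℋ.ε_s, map_one, mul_one]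
      brt2 := by
        change ∃ e : A, ℋ.ε (ℋ.t e) = ℋ.ε 1 ∧ Set.BijOn (fun a => ℋ.ε (ℋ.t a))
          (Ideal.span {e} : Ideal A) (Ideal.span {ℋ.ε 1} : Ideal A)
        simp only [ℋ.ε_t, map_one]
        exact ⟨1, rfl, Set.bijOn_id _⟩ }

theorem one_apply (h : H) : (1 : Biretraction ℋ) h = ℋ.ε h := rfl

theorem exists_convLin₃ (α β γ : Biretraction ℋ) : ∃ F : BalTensor₃ ℋ.s ℋ.t →ₗ[k] A, ∀ x y z,
    F (BalTensor₃.in₁ ℋ.s ℋ.t x * BalTensor₃.in₂ ℋ.s ℋ.t y * BalTensor₃.in₃ ℋ.s ℋ.t z) =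
      γ (ℋ.t (β (ℋ.t (α x)) * β y)) * γ z := by
  refine ⟨BalTensor₃.linLift ℋ.s ℋ.t
    (LinearMap.mk₂ k (fun x w => γ (ℋ.t (β (ℋ.t (α x)))) * convLin β γ w)
      (fun x x' y => by simp [add_mul]) (fun c x y => by simp) (fun x y y' => by simp [mul_add])
      (fun c x y => by simp)) ?_, fun x y z => ?_⟩
  · intro a x w
    simp only [LinearMap.mk₂_apply]
    rw [convLin_mul, convLin_inl, mul', s', mul_left_comm, mul_one', ← mul_assoc, ← mul', ← map_mul,
      ← mul', ← map_mul, mul_comm a]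
  · rw [BalTensor₃.linLift_apply]
    simp only [LinearMap.mk₂_apply]
    rw [convLin_apply, map_mul, mul', mul_assoc]

theorem mul_assoc' (α β γ : Biretraction ℋ) : α * β * γ = α * (β * γ) := by
  refine ext' fun h => ?_
  -- both sides are the value on `h₁ ⊗ h₂ ⊗ h₃` of `x ⊗ y ⊗ z ↦ γ(t(β(t(α(x))) β(y))) γ(z)`
  obtain ⟨F, hF⟩ := exists_convLin₃ α β γ
  have h1 : ∀ w : BalTensor ℋ.s ℋ.t, ∀ z,
      F (BalTensor₃.in₁₂ ℋ.s ℋ.t w * BalTensor₃.in₃ ℋ.s ℋ.t z) =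
        γ (ℋ.t (convLin α β w)) * γ z := by
    intro w z
    induction w using BalTensor.induction with
    | zero => simp
    | add w w' h h' => rw [map_add, add_mul, map_add, h, h', map_add, map_add, add', add_mul]
    | tmul x y =>
      rw [convLin_apply, map_mul (BalTensor₃.in₁₂ ℋ.s ℋ.t), BalTensor₃.in₁₂_inl, BalTensor₃.in₁₂_inr, hF]
  have h2 : ∀ w : BalTensor ℋ.s ℋ.t, ∀ x,
      F (BalTensor₃.in₁ ℋ.s ℋ.t x * BalTensor₃.in₂₃ ℋ.s ℋ.t w) =
        γ (ℋ.t (β (ℋ.t (α x)))) * convLin β γ w := by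
    intro w x
    induction w using BalTensor.induction with
    | zero => simp
    | add w w' h h' => rw [map_add, mul_add, map_add, h, h', map_add, mul_add]
    | tmul y z =>
      rw [convLin_apply, map_mul (BalTensor₃.in₂₃ ℋ.s ℋ.t), BalTensor₃.in₂₃_inl,
        BalTensor₃.in₂₃_inr, ← mul_assoc (BalTensor₃.in₁ ℋ.s ℋ.t x), hF,
        map_mul ℋ.t, mul', mul_assoc]
  have e1 : ∀ w, convLin (α * β) γ w = F (BalTensor.lift ((BalTensor₃.in₁₂ ℋ.s ℋ.t).comp ℋ.Δ)
      (BalTensor₃.in₃ ℋ.s ℋ.t) (fun a => by rw [AlgHom.comp_apply, ℋ.Δ_s, BalTensor₃.in₁₂_inr, BalTensor₃.in₂_src]) w) := by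
    intro w
    induction w using BalTensor.induction with
    | zero => simp
    | add w w' h h' => rw [map_add, h, h', map_add, map_add]
    | tmul x y =>
      rw [convLin_apply, mul_apply, ← h1, BalTensor.lift_tmul]
      rfl
  have e2 : ∀ w, convLin α (β * γ) w = F (BalTensor.lift (BalTensor₃.in₁ ℋ.s ℋ.t)
      ((BalTensor₃.in₂₃ ℋ.s ℋ.t).comp ℋ.Δ)
      (fun a => by rw [AlgHom.comp_apply, ℋ.Δ_t, BalTensor₃.in₂₃_inl, BalTensor₃.in₁_src]) w) := by
    intro w
    induction w using BalTensor.induction with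
    | zero => simp
    | add w w' h h' => rw [map_add, h, h', map_add, map_add]
    | tmul x y =>
      rw [convLin_apply, mul_t, mul_apply, BalTensor.lift_tmul]
      exact (h2 _ _).symm
  rw [mul_apply, mul_apply, e1, e2, ℋ.coassoc]

theorem mul_pinv_apply (α : Biretraction ℋ) (h : H) : (α * α.pinv) h = ℋ.ε h * α.e := by
  rw [mul_apply, ← tinv_t, ← ℋ.S_right]
  generalize ℋ.Δ h = w
  induction w using BalTensor.induction with
  | zero => simpa using (α.tinv_eq (by simp) (by simp)).symm
  | add w w' h h' =>
    rw [map_add, h, h', map_add]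
    exact (α.tinv_eq (by simp [add_mul, tinv_mem]) (by simp [t_tinv])).symm
  | tmul x y =>
    rw [convLin_apply, pinv_apply, pinv_apply, ℋ.S_t, ← tinv_mul, BalTensor.lift_tmul]
    refine α.tinv_congr ?_
    rw [mul', s', AlgHom.id_apply, mul_one', mul']

theorem pinv_mul_apply (α : Biretraction ℋ) (h : H) : (α.pinv * α) h = ℋ.ε h * α 1 := by
  rw [mul_apply, ← s', ← ℋ.S_left]
  generalize ℋ.Δ h = w
  induction w using BalTensor.induction with
  | zero => simp
  | add w w' h h' => rw [map_add, h, h', map_add, add']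
  | tmul x y =>
    rw [convLin_apply, pinv_apply, t_tinv, BalTensor.lift_tmul, mul']
    rfl

theorem conv_of_counit (α β : Biretraction ℋ)
    (h : ∀ x, β (ℋ.t (α x)) * β 1 = β (ℋ.t (ℋ.ε x)) * β 1) : α * β = β := by
  refine ext' fun x => ?_
  rw [mul_apply]
  conv_rhs => rw [← ℋ.ε_left x]
  generalize ℋ.Δ x = w
  induction w using BalTensor.induction with
  | zero => simp
  | add w w' h h' => rw [map_add, h, h', map_add, add']
  | tmul x y =>
    rw [convLin_apply, BalTensor.lift_tmul, mul', ← mul_one', h,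
      mul_one']
    rfl

theorem mul_one'' (α : Biretraction ℋ) : α * 1 = α := by
  refine ext' fun x => ?_
  rw [mul_apply]
  conv_rhs => rw [← ℋ.ε_right x]
  generalize ℋ.Δ x = w
  induction w using BalTensor.induction with
  | zero => simp
  | add w w' h h' => rw [map_add, h, h', map_add, add']
  | tmul x y =>
    rw [convLin_apply, BalTensor.lift_tmul, mul', one_apply, one_apply,
      ℋ.ε_t, AlgHom.comp_apply, s', mul_left_comm, mul_one', mul_comm]
    rfl

/-- The local biretractions form a regular monoid under convolution. -/
instance : RegularMonoid (Biretraction ℋ) where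
  mul_assoc := mul_assoc'
  one_mul β := conv_of_counit 1 β fun x => by rw [one_apply]
  mul_one := mul_one''
  pinv := pinv
  mul_pinv_mul α := conv_of_counit _ α fun x => by
    rw [mul_pinv_apply, map_mul, mul', t_e, mul_assoc, mul_one']
  pinv_mul_pinv α := conv_of_counit _ α.pinv fun x => by
    have h1 : α.pinv (ℋ.t (α 1)) = α.pinv 1 := by
      rw [pinv_apply, pinv_apply, ℋ.S_t, map_one ℋ.S]
      exact α.tinv_congr (by rw [s', mul_one'])
    rw [pinv_mul_apply, map_mul ℋ.t, mul', h1, mul_assoc, mul_one']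

end Biretraction

end HopfAlgebroid


/-! ### The algebra of representative functions of a groupoid -/

section RepresentativeFunctions

universe u v w

/-- A finite-dimensional `𝒢`-representation: `k`-vector spaces `E x` of the same finite dimension
`n` and linear maps `ρ g : E (s g) → E (t g)` with `ρ (id) = id` and `ρ (g h) = ρ g ∘ ρ h`; the
`ρ g` are then isomorphisms. -/
structure GRep (k : Type w) [Field k] (G : Type u) [Groupoid.{v} G] where
  n : ℕ
  E : G → Type w
  [acg : ∀ x, AddCommGroup (E x)]
  [mod : ∀ x, Module k (E x)]
  [fin : ∀ x, Module.Finite k (E x)]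
  finrank_eq : ∀ x, Module.finrank k (E x) = n
  ρ : ∀ {x y : G}, (x ⟶ y) → (E x →ₗ[k] E y)
  ρ_id : ∀ x, ρ (𝟙 x) = LinearMap.id
  ρ_comp : ∀ {x y z : G} (h : x ⟶ y) (g : y ⟶ z), ρ (h ≫ g) = ρ g ∘ₗ ρ h

attribute [instance] GRep.acg GRep.mod GRep.fin

variable {k : Type w} [Field k] {G : Type u} [Groupoid.{v} G]

namespace GRep

/-- Morphisms of `𝒢`-representations. -/
structure Hom (E F : GRep k G) where
  app : ∀ x, E.E x →ₗ[k] F.E x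
  comm : ∀ {x y : G} (g : x ⟶ y), F.ρ g ∘ₗ app x = app y ∘ₗ E.ρ g

/-- The sections `Γ(E)`. -/
abbrev Sec (E : GRep k G) : Type _ := ∀ x, E.E x

/-- The sections `Γ(E^*)`. -/
abbrev DualSec (E : GRep k G) : Type _ := ∀ x, Module.Dual k (E.E x)

/-- `λ p` for a section `p` and a morphism `λ`. -/
def Hom.push {E F : GRep k G} (f : Hom E F) : Sec E →ₗ[k] Sec F where
  toFun p x := f.app x (p x)
  map_add' p q := by ext; simp
  map_smul' c p := by ext; simp

/-- `φ λ` for a section `φ` of the dual and a morphism `λ`. -/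
def Hom.pull {E F : GRep k G} (f : Hom E F) : DualSec F →ₗ[k] DualSec E where
  toFun φ x := φ x ∘ₗ f.app x
  map_add' p q := by ext; simp
  map_smul' c p := by ext; simp

/-- The trivial representation. -/
def triv : GRep k G where
  n := 1
  E _ := k
  finrank_eq _ := Module.finrank_self k
  ρ _ := LinearMap.id
  ρ_id _ := rfl
  ρ_comp _ _ := rfl

/-- The identification of `k` with a fibre of the trivial representation. -/
def tk (x : G) : k →ₗ[k] (triv : GRep k G).E x := LinearMap.id

/-- The identification of a fibre of the trivial representation with `k`. -/
def utk (x : G) : (triv : GRep k G).E x →ₗ[k] k := LinearMap.id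

@[simp] theorem utk_tk (x : G) (c : k) : utk x (tk x c) = c := rfl
@[simp] theorem tk_utk (x : G) (c : (triv : GRep k G).E x) : tk x (utk x c) = c := rfl
@[simp] theorem utk_ρ {x y : G} (g : x ⟶ y) (c : (triv : GRep k G).E x) :
    utk y ((triv : GRep k G).ρ g c) = utk x c := rfl

/-- The tensor product of representations. -/
def tensor (E F : GRep k G) : GRep k G where
  n := E.n * F.n
  E x := E.E x ⊗[k] F.E x
  finrank_eq x := by rw [Module.finrank_tensorProduct, E.finrank_eq, F.finrank_eq]
  ρ g := TensorProduct.map (E.ρ g) (F.ρ g)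
  ρ_id x := by rw [E.ρ_id, F.ρ_id, TensorProduct.map_id]
  ρ_comp h g := by rw [E.ρ_comp, F.ρ_comp, TensorProduct.map_comp]

section tensor

variable {E F : GRep k G} {x : G}

variable (E F x) in
/-- `a ⊗ b` in a fibre of `E ⊗ F`. -/
def tmk : E.E x →ₗ[k] F.E x →ₗ[k] (tensor E F).E x := TensorProduct.mk k (E.E x) (F.E x)

/-- The linear map on a fibre of `E ⊗ F` induced by a bilinear map. -/
def tlift {M : Type*} [AddCommGroup M] [Module k M] (f : E.E x →ₗ[k] F.E x →ₗ[k] M) :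
    (tensor E F).E x →ₗ[k] M :=
  show E.E x ⊗[k] F.E x →ₗ[k] M from TensorProduct.lift f

@[simp] theorem tlift_tmk {M : Type*} [AddCommGroup M] [Module k M]
    (f : E.E x →ₗ[k] F.E x →ₗ[k] M) (a : E.E x) (b : F.E x) :
    tlift f (tmk E F x a b) = f a b := TensorProduct.lift.tmul _ _

theorem tensor_ext {M : Type*} [AddCommGroup M] [Module k M] {f g : (tensor E F).E x →ₗ[k] M}
    (h : ∀ a b, f (tmk E F x a b) = g (tmk E F x a b)) : f = g := by
  change (show E.E x ⊗[k] F.E x →ₗ[k] M from f) = (show E.E x ⊗[k] F.E x →ₗ[k] M from g)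
  exact TensorProduct.ext' h

theorem tensor_ext₃ {D : GRep k G} {M : Type*} [AddCommGroup M] [Module k M]
    {f g : (tensor (tensor E F) D).E x →ₗ[k] M}
    (h : ∀ a b c, f (tmk _ D x (tmk E F x a b) c) = g (tmk _ D x (tmk E F x a b) c)) : f = g := by
  refine tensor_ext fun u c => ?_
  have := tensor_ext (f := f ∘ₗ (tmk (tensor E F) D x).flip c)
    (g := g ∘ₗ (tmk (tensor E F) D x).flip c) fun a b => h a b c
  exact LinearMap.congr_fun this u

@[simp] theorem tensor_ρ {y : G} (g : x ⟶ y) (a : E.E x) (b : F.E x) :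
    (tensor E F).ρ g (tmk E F x a b) = tmk E F y (E.ρ g a) (F.ρ g b) :=
  TensorProduct.map_tmul _ _ _ _

end tensor

theorem Hom.comm_apply {E F : GRep k G} (f : Hom E F) {x y : G} (g : x ⟶ y) (a : E.E x) :
    F.ρ g (f.app x a) = f.app y (E.ρ g a) := LinearMap.congr_fun (f.comm g) a

/-- The dual representation, `ρ g φ = φ ∘ ρ g⁻¹`. -/
def dual (E : GRep k G) : GRep k G where
  n := E.n
  E x := Module.Dual k (E.E x)
  finrank_eq x := by rw [Subspace.dual_finrank_eq, E.finrank_eq]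
  ρ g := (E.ρ (Groupoid.inv g)).dualMap
  ρ_id x := by
    have : Groupoid.inv (𝟙 x) = 𝟙 x := by simp
    rw [this, E.ρ_id, LinearMap.dualMap_id]
  ρ_comp h g := by
    have : Groupoid.inv (h ≫ g) = Groupoid.inv g ≫ Groupoid.inv h := by simp
    rw [this, E.ρ_comp, LinearMap.dualMap_comp_dualMap]

/-- A basis of each fibre. -/
def basis (E : GRep k G) (x : G) : Module.Basis (Fin E.n) k (E.E x) :=
  Module.finBasisOfFinrankEq k (E.E x) (E.finrank_eq x)

end GRep

open GRep

/-- The tensor product `Γ(E^*) ⊗ Γ(E)` over `k`. -/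
def RepSummand (E : GRep k G) : Type _ := DualSec E ⊗[k] Sec E

instance (E : GRep k G) : AddCommGroup (RepSummand E) :=
  inferInstanceAs (AddCommGroup (DualSec E ⊗[k] Sec E))

instance (E : GRep k G) : Module k (RepSummand E) :=
  inferInstanceAs (Module k (DualSec E ⊗[k] Sec E))

variable (k G) in
/-- The direct sum of all `Γ(E^*) ⊗ Γ(E)`. -/
abbrev RepSum : Type _ := DirectSum (GRep k G) fun E => RepSummand E

/-- The bilinear map `(φ, p) ↦ φ ⊗ p`. -/
def RepSummand.tmul (E : GRep k G) : DualSec E →ₗ[k] Sec E →ₗ[k] RepSummand E :=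
  TensorProduct.mk k (DualSec E) (Sec E)

open Classical in
/-- The element `φ ⊗ p` of the summand with index `E`. -/
def RepSum.of (E : GRep k G) (φ : DualSec E) (p : Sec E) : RepSum k G :=
  DirectSum.lof k (GRep k G) RepSummand E (RepSummand.tmul E φ p)

variable (k G) in
/-- The span of all `φ ⊗ λ p - φ λ ⊗ p` with `λ : E → F` a morphism of representations. The case
`E = F` turns the tensor products over `k` into tensor products over `End(E)`, and the case of an
isomorphism identifies the summands of isomorphic representations. -/
def repRel : Submodule k (RepSum k G) :=
  Submodule.span k {z | ∃ (E F : GRep k G) (f : Hom E F) (φ : DualSec F) (p : Sec E),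
    z = RepSum.of F φ (f.push p) - RepSum.of E (f.pull φ) p}

variable (k G) in
/-- The algebra `R_k(𝒢)` of representative functions of the groupoid `𝒢`. -/
def RepFun : Type _ := RepSum k G ⧸ repRel k G

namespace RepFun

instance : AddCommGroup (RepFun k G) := inferInstanceAs (AddCommGroup (RepSum k G ⧸ repRel k G))

instance : Module k (RepFun k G) := inferInstanceAs (Module k (RepSum k G ⧸ repRel k G))

/-- The quotient map. -/
def proj : RepSum k G →ₗ[k] RepFun k G := (repRel k G).mkQ

/-- The class of `φ ⊗ p`, for `φ` a section of `E^*` and `p` a section of `E`. -/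
def mk (E : GRep k G) (φ : DualSec E) (p : Sec E) : RepFun k G := proj (RepSum.of E φ p)

/-- `mk` as a bilinear map. -/
def mkₗ (E : GRep k G) : DualSec E →ₗ[k] Sec E →ₗ[k] RepFun k G :=
  LinearMap.mk₂ k (mk E)
    (fun φ φ' p => by simp [mk, RepSum.of])
    (fun c φ p => by simp [mk, RepSum.of])
    (fun φ p p' => by simp [mk, RepSum.of])
    (fun c φ p => by simp [mk, RepSum.of])

theorem mkₗ_apply (E : GRep k G) (φ : DualSec E) (p : Sec E) : mkₗ E φ p = mk E φ p := rfl

theorem mk_add_left (E : GRep k G) (φ φ' : DualSec E) (p : Sec E) :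
    mk E (φ + φ') p = mk E φ p + mk E φ' p := (mkₗ E).map_add₂ φ φ' p

theorem mk_add_right (E : GRep k G) (φ : DualSec E) (p p' : Sec E) :
    mk E φ (p + p') = mk E φ p + mk E φ p' := (mkₗ E φ).map_add p p'

theorem mk_smul_left (E : GRep k G) (c : k) (φ : DualSec E) (p : Sec E) :
    mk E (c • φ) p = c • mk E φ p := (mkₗ E).map_smul₂ c φ p

theorem mk_smul_right (E : GRep k G) (c : k) (φ : DualSec E) (p : Sec E) :
    mk E φ (c • p) = c • mk E φ p := (mkₗ E φ).map_smul c p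

theorem mk_hom {E F : GRep k G} (f : Hom E F) (φ : DualSec F) (p : Sec E) :
    mk F φ (f.push p) = mk E (f.pull φ) p :=
  (Submodule.Quotient.eq _).2 (Submodule.subset_span ⟨E, F, f, φ, p, rfl⟩)

theorem mk_eq {E F : GRep k G} (f : Hom E F) {φ : DualSec E} {ψ : DualSec F} {p : Sec E}
    {q : Sec F} (h1 : ∀ x, φ x = ψ x ∘ₗ f.app x) (h2 : ∀ x, q x = f.app x (p x)) :
    mk E φ p = mk F ψ q := by
  obtain rfl : φ = f.pull ψ := funext h1
  obtain rfl : q = f.push p := funext h2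
  exact (mk_hom f ψ p).symm

open Classical in
@[elab_as_elim]
theorem induction {P : RepFun k G → Prop} (z : RepFun k G) (of : ∀ E φ p, P (mk E φ p))
    (zero : P 0) (add : ∀ z w, P z → P w → P (z + w)) : P z := by
  obtain ⟨z, rfl⟩ : ∃ w, proj w = z := Submodule.mkQ_surjective _ z
  induction z using DirectSum.induction_on with
  | zero => simpa using zero
  | add z w hz hw => rw [map_add]; exact add _ _ hz hw
  | of E t =>
    change P (proj (DirectSum.lof k (GRep k G) RepSummand E t))
    refine TensorProduct.induction_on (motive := fun t : RepSummand E =>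
      P (proj (DirectSum.lof k (GRep k G) RepSummand E t))) t ?_ (of E) fun z w hz hw => ?_
    · change P (proj (DirectSum.lof k (GRep k G) RepSummand E (0 : RepSummand E)))
      simpa using zero
    · have e : DirectSum.lof k (GRep k G) RepSummand E (z + w : DualSec E ⊗[k] Sec E) =
          DirectSum.lof k (GRep k G) RepSummand E z + DirectSum.lof k (GRep k G) RepSummand E w :=
        (DirectSum.lof k (GRep k G) RepSummand E).map_add z w
      rw [e, map_add]
      exact add _ _ hz hw

theorem hom_ext {M : Type*} [AddCommGroup M] [Module k M] {f g : RepFun k G →ₗ[k] M}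
    (h : ∀ E φ p, f (mk E φ p) = g (mk E φ p)) : f = g := by
  ext z
  induction z using RepFun.induction with
  | of E φ p => exact h E φ p
  | zero => simp
  | add z w hz hw => simp [hz, hw]

/-- The linear map on `Γ(E^*) ⊗ Γ(E)` induced by a bilinear map. -/
def liftSummand {M : Type*} [AddCommGroup M] [Module k M] {E : GRep k G}
    (f : DualSec E →ₗ[k] Sec E →ₗ[k] M) : RepSummand E →ₗ[k] M :=
  show DualSec E ⊗[k] Sec E →ₗ[k] M from TensorProduct.lift f

theorem liftSummand_tmul {M : Type*} [AddCommGroup M] [Module k M] {E : GRep k G}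
    (f : DualSec E →ₗ[k] Sec E →ₗ[k] M) (φ : DualSec E) (p : Sec E) :
    liftSummand f (RepSummand.tmul E φ p) = f φ p :=
  TensorProduct.lift.tmul _ _

open Classical in
/-- A family of bilinear maps compatible with morphisms induces a linear map on `R_k(𝒢)`. -/
def lift {M : Type*} [AddCommGroup M] [Module k M]
    (f : ∀ E : GRep k G, DualSec E →ₗ[k] Sec E →ₗ[k] M)
    (hf : ∀ (E F : GRep k G) (a : Hom E F) φ p, f F φ (a.push p) = f E (a.pull φ) p) :
    RepFun k G →ₗ[k] M :=
  (repRel k G).liftQ (DirectSum.toModule k (GRep k G) M fun E => liftSummand (f E)) (by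
    rw [repRel, Submodule.span_le]
    rintro _ ⟨E, F, a, φ, p, rfl⟩
    simp [RepSum.of, liftSummand_tmul, hf])

open Classical in
@[simp] theorem lift_mk {M : Type*} [AddCommGroup M] [Module k M]
    (f : ∀ E : GRep k G, DualSec E →ₗ[k] Sec E →ₗ[k] M)
    (hf : ∀ (E F : GRep k G) (a : Hom E F) φ p, f F φ (a.push p) = f E (a.pull φ) p)
    (E : GRep k G) (φ : DualSec E) (p : Sec E) : lift f hf (mk E φ p) = f E φ p := by
  change DirectSum.toModule k (GRep k G) M (fun E => liftSummand (f E))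
    (DirectSum.lof k (GRep k G) RepSummand E (RepSummand.tmul E φ p)) = _
  simp [liftSummand_tmul]

/-! #### Multiplication -/

/-- The section `p ⊗ q` of `E ⊗ F`. -/
def tsec (E F : GRep k G) : Sec E →ₗ[k] Sec F →ₗ[k] Sec (tensor E F) :=
  LinearMap.mk₂ k (fun p q x => tmk E F x (p x) (q x))
    (fun _ _ _ => by ext; simp)
    (fun _ _ _ => by ext; simp)
    (fun _ _ _ => by ext; simp)
    (fun _ _ _ => by ext; simp)

/-- The section `φ ⊗ ψ` of `(E ⊗ F)^*`. -/
def tdual (E F : GRep k G) : DualSec E →ₗ[k] DualSec F →ₗ[k] DualSec (tensor E F) :=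
  LinearMap.mk₂ k (fun φ ψ x => tlift ((LinearMap.mul k k).compl₁₂ (φ x) (ψ x)))
    (fun _ _ _ => funext fun _ => tensor_ext fun _ _ => by simp)
    (fun _ _ _ => funext fun _ => tensor_ext fun _ _ => by simp [mul_assoc])
    (fun _ _ _ => funext fun _ => tensor_ext fun _ _ => by simp [mul_add])
    (fun _ _ _ => funext fun _ => tensor_ext fun _ _ => by simp [mul_left_comm])

theorem tsec_apply (E F : GRep k G) (p : Sec E) (q : Sec F) (x : G) :
    tsec E F p q x = tmk E F x (p x) (q x) := rfl

@[simp] theorem tdual_apply (E F : GRep k G) (φ : DualSec E) (ψ : DualSec F) (x : G) (a : E.E x)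
    (b : F.E x) : tdual E F φ ψ x (tmk E F x a b) = φ x a * ψ x b :=
  tlift_tmk _ _ _

/-- The tensor product of two morphisms. -/
def homTensor {E E' F F' : GRep k G} (f : Hom E E') (g : Hom F F') :
    Hom (tensor E F) (tensor E' F') where
  app x := tlift ((tmk E' F' x).compl₁₂ (f.app x) (g.app x))
  comm a := tensor_ext fun p q => by simp [Hom.comm_apply]

/-- The identity morphism. -/
def homId (E : GRep k G) : Hom E E where
  app _ := LinearMap.id
  comm _ := rfl

theorem mk_tensor_hom {E E' F F' : GRep k G} (f : Hom E E') (g : Hom F F') (φ : DualSec E')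
    (ψ : DualSec F') (p : Sec E) (q : Sec F) :
    mk (tensor E' F') (tdual E' F' φ ψ) (tsec E' F' (f.push p) (g.push q)) =
      mk (tensor E F) (tdual E F (f.pull φ) (g.pull ψ)) (tsec E F p q) := by
  refine (mk_eq (homTensor f g) (fun x => ?_) fun x => ?_).symm
  · exact tensor_ext fun a b => by simp [homTensor, Hom.pull]
  · simp [homTensor, tsec_apply, Hom.push]

/-- Multiplication by the class of `φ ⊗ p`. -/
def mulLeft (E : GRep k G) (φ : DualSec E) (p : Sec E) : RepFun k G →ₗ[k] RepFun k G :=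
  lift (fun F => ((mkₗ (tensor E F)).compl₁₂ (tdual E F φ) (tsec E F p)))
    (by
      intro F F' a ψ q
      exact mk_tensor_hom (homId E) a φ ψ p q)

theorem mulLeft_mk (E F : GRep k G) (φ : DualSec E) (p : Sec E) (ψ : DualSec F) (q : Sec F) :
    mulLeft E φ p (mk F ψ q) = mk (tensor E F) (tdual E F φ ψ) (tsec E F p q) :=
  lift_mk _ _ F ψ q

/-- The multiplication of `R_k(𝒢)`, `(φ ⊗ p)(ψ ⊗ q) = (φ ⊗ ψ) ⊗ (p ⊗ q)`; see `mk_mul_mk`. -/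
def mulₗ : RepFun k G →ₗ[k] RepFun k G →ₗ[k] RepFun k G :=
  lift (fun E => LinearMap.mk₂ k (mulLeft E)
      (fun φ φ' p => hom_ext fun F ψ q => by
        simp only [LinearMap.add_apply, mulLeft_mk, mk_add_left, mk_add_right, map_add])
      (fun c φ p => hom_ext fun F ψ q => by
        simp only [LinearMap.smul_apply, mulLeft_mk, mk_smul_left, mk_smul_right, map_smul])
      (fun φ p p' => hom_ext fun F ψ q => by
        simp only [LinearMap.add_apply, mulLeft_mk, mk_add_left, mk_add_right, map_add])
      (fun c φ p => hom_ext fun F ψ q => by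
        simp only [LinearMap.smul_apply, mulLeft_mk, mk_smul_left, mk_smul_right, map_smul]))
    (by
      intro E E' a φ p
      refine hom_ext fun F ψ q => ?_
      simp only [LinearMap.mk₂_apply, mulLeft_mk]
      exact mk_tensor_hom a (homId F) φ ψ p q)

instance : Mul (RepFun k G) := ⟨fun a b => mulₗ a b⟩

theorem mul_def (a b : RepFun k G) : a * b = mulₗ a b := rfl

theorem mk_mul_mk (E F : GRep k G) (φ : DualSec E) (p : Sec E) (ψ : DualSec F) (q : Sec F) :
    mk E φ p * mk F ψ q = mk (tensor E F) (tdual E F φ ψ) (tsec E F p q) := by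
  rw [mul_def, mulₗ, lift_mk, LinearMap.mk₂_apply, mulLeft_mk]

/-- A function on the unit space as a section of the trivial representation. -/
def trivSec (b : G → k) : Sec (triv : GRep k G) := fun x => tk x (b x)

/-- A function on the unit space as a section of the dual of the trivial representation. -/
def trivDual (a : G → k) : DualSec (triv : GRep k G) := fun x => a x • utk x

/-- The class of `a ⊗ b` for functions `a`, `b` on the unit space. -/
def ab (a b : G → k) : RepFun k G := mk triv (trivDual a) (trivSec b)

instance : One (RepFun k G) := ⟨ab (fun _ => 1) (fun _ => 1)⟩

theorem one_def : (1 : RepFun k G) = ab (fun _ => 1) (fun _ => 1) := rfl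

/-- `E ⊗ F ≅ F ⊗ E` -/
def homComm (E F : GRep k G) : Hom (tensor E F) (tensor F E) where
  app x := tlift (tmk F E x).flip
  comm g := tensor_ext fun a b => by simp

/-- `(E ⊗ F) ⊗ D ≅ E ⊗ (F ⊗ D)` -/
def homAssoc (E F D : GRep k G) : Hom (tensor (tensor E F) D) (tensor E (tensor F D)) where
  app x := tlift (tlift (LinearMap.mk₂ k (fun a b => tmk E (tensor F D) x a ∘ₗ tmk F D x b)
    (fun _ _ _ => by ext; simp) (fun _ _ _ => by ext; simp) (fun _ _ _ => by ext; simp)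
    (fun _ _ _ => by ext; simp)))
  comm g := tensor_ext₃ fun a b c => by simp

/-- `I ⊗ E ≅ E` -/
def homUnit (E : GRep k G) : Hom (tensor triv E) E where
  app x := tlift (LinearMap.lsmul k (E.E x) ∘ₗ utk x)
  comm g := tensor_ext fun a b => by simp

theorem ab_mul_mk (a b : G → k) (E : GRep k G) (φ : DualSec E) (p : Sec E) :
    ab a b * mk E φ p = mk E (fun x => a x • φ x) (fun x => b x • p x) := by
  rw [ab, mk_mul_mk]
  refine mk_eq (homUnit E) (fun x => ?_) fun x => ?_
  · exact tensor_ext fun c e => by simp [homUnit, trivDual]; ring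
  · simp [homUnit, tsec_apply, trivSec]

theorem mul_comm' (a b : RepFun k G) : a * b = b * a := by
  induction a using RepFun.induction with
  | zero => simp [mul_def]
  | add a a' h h' => simp only [mul_def, map_add, LinearMap.add_apply] at *; rw [h, h']
  | of E φ p =>
    induction b using RepFun.induction with
    | zero => simp [mul_def]
    | add a a' h h' => simp only [mul_def, map_add, LinearMap.add_apply] at *; rw [h, h']
    | of F ψ q =>
      rw [mk_mul_mk, mk_mul_mk]
      refine mk_eq (homComm E F) (fun x => tensor_ext fun c e => ?_) fun x => ?_
      · simp [homComm, mul_comm]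
      · simp [homComm, tsec_apply]

theorem mul_assoc' (a b c : RepFun k G) : a * b * c = a * (b * c) := by
  induction a using RepFun.induction with
  | zero => simp [mul_def]
  | add a a' h h' => simp only [mul_def, map_add, LinearMap.add_apply] at *; rw [h, h']
  | of E φ p =>
    induction b using RepFun.induction with
    | zero => simp [mul_def]
    | add a a' h h' => simp only [mul_def, map_add, LinearMap.add_apply] at *; rw [h, h']
    | of F ψ q =>
      induction c using RepFun.induction with
      | zero => simp [mul_def]
      | add a a' h h' => simp only [mul_def, map_add, LinearMap.add_apply] at *; rw [h, h']
      | of D χ r =>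
        simp only [mk_mul_mk]
        refine mk_eq (homAssoc E F D) (fun x => tensor_ext₃ fun c e f => ?_) fun x => ?_
        · simp [homAssoc, mul_assoc]
        · simp [homAssoc, tsec_apply]

theorem one_mul' (a : RepFun k G) : 1 * a = a := by
  induction a using RepFun.induction with
  | zero => simp [mul_def]
  | add a a' h h' => simp only [mul_def, map_add] at *; rw [h, h']
  | of E φ p => rw [one_def, ab_mul_mk]; simp

instance : CommRing (RepFun k G) where
  mul_assoc := mul_assoc'
  mul_comm := mul_comm'
  one_mul := one_mul'
  mul_one a := by rw [mul_comm', one_mul']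
  left_distrib a b c := map_add (mulₗ a) b c
  right_distrib a b c := LinearMap.congr_fun (map_add mulₗ a b) c
  zero_mul a := by simp [mul_def]
  mul_zero a := by simp [mul_def]
  zsmul := fun n a => n • a
  zsmul_zero' := SubNegMonoid.zsmul_zero'
  zsmul_succ' := SubNegMonoid.zsmul_succ'
  zsmul_neg' := SubNegMonoid.zsmul_neg'
  nsmul := fun n a => n • a
  nsmul_zero := AddMonoid.nsmul_zero
  nsmul_succ := AddMonoid.nsmul_succ
  sub_eq_add_neg := sub_eq_add_neg
  neg_add_cancel := neg_add_cancel

instance : Algebra k (RepFun k G) :=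
  Algebra.ofModule (fun c a b => by rw [mul_def, mul_def, map_smul, LinearMap.smul_apply])
    (fun c a b => by rw [mul_def, mul_def, map_smul])


/-! #### The Hopf algebroid structure -/

theorem ab_mul_ab (a b c d : G → k) : (ab a b : RepFun k G) * ab c d = ab (a * c) (b * d) := by
  refine (ab_mul_mk a b triv (trivDual c) (trivSec d)).trans ?_
  have h1 : (fun x => a x • trivDual c x) = (trivDual (a * c) : DualSec (triv : GRep k G)) :=
    funext fun x => (mul_smul (a x) (c x) (utk x)).symm
  have h2 : (fun x => b x • trivSec d x) = (trivSec (b * d) : Sec (triv : GRep k G)) :=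
    funext fun x => ((tk x).map_smul (b x) (d x)).symm
  rw [h1, h2, ab]

/-- `trivSec` as a linear map. -/
def trivSecₗ : (G → k) →ₗ[k] Sec (triv : GRep k G) where
  toFun := trivSec
  map_add' a b := funext fun x => (tk x).map_add (a x) (b x)
  map_smul' c a := funext fun x => (tk x).map_smul c (a x)

/-- `trivDual` as a linear map. -/
def trivDualₗ : (G → k) →ₗ[k] DualSec (triv : GRep k G) where
  toFun := trivDual
  map_add' a b := funext fun x => add_smul (a x) (b x) (utk x)
  map_smul' c a := funext fun x => mul_smul c (a x) (utk x)

/-- The source map `s(a) = 1 ⊗ a`. -/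
def src : (G → k) →ₐ[k] RepFun k G :=
  AlgHom.ofLinearMap (mkₗ triv (trivDual 1) ∘ₗ trivSecₗ) rfl fun a b => by
    change ab 1 (a * b) = ab 1 a * ab 1 b
    rw [ab_mul_ab, one_mul]

/-- The target map `t(a) = a ⊗ 1`. -/
def tgt : (G → k) →ₐ[k] RepFun k G :=
  AlgHom.ofLinearMap ((mkₗ triv).flip (trivSec 1) ∘ₗ trivDualₗ) rfl fun a b => by
    change ab (a * b) 1 = ab a 1 * ab b 1
    rw [ab_mul_ab, one_mul]

theorem src_apply (a : G → k) : (src a : RepFun k G) = ab 1 a := rfl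
theorem tgt_apply (a : G → k) : (tgt a : RepFun k G) = ab a 1 := rfl

theorem src_mul_mk (a : G → k) (E : GRep k G) (φ : DualSec E) (p : Sec E) :
    src a * mk E φ p = mk E φ (fun x => a x • p x) := by
  rw [src_apply, ab_mul_mk]
  simp

theorem tgt_mul_mk (a : G → k) (E : GRep k G) (φ : DualSec E) (p : Sec E) :
    tgt a * mk E φ p = mk E (fun x => a x • φ x) p := by
  rw [tgt_apply, ab_mul_mk]
  simp

theorem mk_sum_left {ι : Type*} (s : Finset ι) (E : GRep k G) (φ : ι → DualSec E) (p : Sec E) :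
    mk E (∑ i ∈ s, φ i) p = ∑ i ∈ s, mk E (φ i) p := by
  rw [← mkₗ_apply, map_sum, LinearMap.sum_apply]
  rfl

theorem mk_sum_right {ι : Type*} (s : Finset ι) (E : GRep k G) (φ : DualSec E) (p : ι → Sec E) :
    mk E φ (∑ i ∈ s, p i) = ∑ i ∈ s, mk E φ (p i) := by
  rw [← mkₗ_apply, map_sum]
  rfl

/-- `h ↦ h ⊗ 1` in `R ⊗_A R`. -/
def il : RepFun k G →ₐ[k] BalTensor (src (k := k) (G := G)) tgt :=
  BalTensor.inl (k := k) (A := G → k) (H := RepFun k G) src tgt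

/-- `h ↦ 1 ⊗ h` in `R ⊗_A R`. -/
def ir : RepFun k G →ₐ[k] BalTensor (src (k := k) (G := G)) tgt :=
  BalTensor.inr (k := k) (A := G → k) (H := RepFun k G) src tgt

theorem il_src (a : G → k) : il (src a : RepFun k G) = ir (tgt a) :=
  BalTensor.inl_src (k := k) (A := G → k) (H := RepFun k G) src tgt a

theorem comul_aux {ι κ : Type*} [Fintype ι] [Fintype κ] {E F : GRep k G}
    (f : ∀ x, E.E x →ₗ[k] F.E x) (b : ∀ x, Module.Basis ι k (E.E x))
    (c : ∀ x, Module.Basis κ k (F.E x)) (φ : DualSec F) (p : Sec E) :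
    ∑ i, il (mk F φ fun x => f x (b x i)) * ir (mk E (fun x => (b x).coord i) p) =
      ∑ j, il (mk F φ fun x => c x j) * ir (mk E (fun x => (c x).coord j ∘ₗ f x) p) := by
  have h1 : ∀ i, (mk F φ fun x => f x (b x i)) =
      ∑ j, src (fun x => (c x).coord j (f x (b x i))) * mk F φ fun x => c x j := by
    intro i
    simp only [src_mul_mk, ← mk_sum_right]
    congr 1
    ext x
    simp [Module.Basis.sum_repr]
  have h2 : ∀ j, mk E (fun x => (c x).coord j ∘ₗ f x) p =
      ∑ i, tgt (fun x => (c x).coord j (f x (b x i))) * mk E (fun x => (b x).coord i) p := by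
    intro j
    simp only [tgt_mul_mk, ← mk_sum_left]
    congr 1
    funext x
    refine (b x).ext fun i => ?_
    classical
    simp [Finsupp.single_apply]
  simp only [h1, h2, map_sum, map_mul, Finset.sum_mul, Finset.mul_sum]
  rw [Finset.sum_comm]
  refine Finset.sum_congr rfl fun j _ => Finset.sum_congr rfl fun i _ => ?_
  rw [il_src]
  ring

/-- The comultiplication, `Δ(φ ⊗ p) = ∑ i, (φ ⊗ eᵢ) ⊗_A (eᵢ^* ⊗ p)` for bases `eᵢ` of the fibres. -/
def comulₗ : RepFun k G →ₗ[k] BalTensor (src (k := k) (G := G)) tgt :=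
  lift (fun E => ∑ i, (LinearMap.mul k (BalTensor (src (k := k) (G := G)) tgt)).compl₁₂
      (il.toLinearMap ∘ₗ (mkₗ E).flip fun x => E.basis x i)
      (ir.toLinearMap ∘ₗ mkₗ E fun x => (E.basis x).coord i))
    (by
      intro E F f φ p
      simp only [LinearMap.sum_apply]
      have := comul_aux f.app E.basis F.basis φ p
      refine Eq.trans ?_ (this.symm.trans ?_)
      · refine Finset.sum_congr rfl fun j _ => ?_
        change il (mk F φ _) * ir (mk F _ (f.push p)) = _
        rw [mk_hom]
        rfl
      · refine Finset.sum_congr rfl fun j _ => ?_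
        change il (mk F φ (f.push fun x => E.basis x j)) * _ = _
        rw [mk_hom]
        rfl)

theorem comulₗ_mk {ι : Type*} [Fintype ι] (E : GRep k G) (b : ∀ x, Module.Basis ι k (E.E x))
    (φ : DualSec E) (p : Sec E) : comulₗ (mk E φ p) =
      ∑ i, il (mk E φ fun x => b x i) * ir (mk E (fun x => (b x).coord i) p) := by
  have h : comulₗ (mk E φ p) = _ := lift_mk _ _ E φ p
  rw [h]
  simp only [LinearMap.sum_apply]
  exact comul_aux (fun _ => LinearMap.id) E.basis b φ p

/-- The basis `eᵢ ⊗ fⱼ` of a fibre of `E ⊗ F`. -/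
def tbasis (E F : GRep k G) (x : G) : Module.Basis (Fin E.n × Fin F.n) k ((tensor E F).E x) :=
  (E.basis x).tensorProduct (F.basis x)

theorem tbasis_apply (E F : GRep k G) (x : G) (i : Fin E.n × Fin F.n) :
    tbasis E F x i = tmk E F x (E.basis x i.1) (F.basis x i.2) :=
  Module.Basis.tensorProduct_apply' _ _ _

theorem tbasis_coord (E F : GRep k G) (i : Fin E.n × Fin F.n) :
    (fun x => (tbasis E F x).coord i) =
      tdual E F (fun x => (E.basis x).coord i.1) (fun x => (F.basis x).coord i.2) := by
  funext x
  refine tensor_ext fun a b => ?_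
  rw [tdual_apply]
  exact (Module.Basis.tensorProduct_repr_tmul_apply _ _ _ _ _ _).trans (by simp [mul_comm])

/-- The basis of a fibre of the trivial representation. -/
def trivBasis (x : G) : Module.Basis Unit k ((triv : GRep k G).E x) :=
  show Module.Basis Unit k k from Module.Basis.singleton Unit k

theorem trivBasis_apply (x : G) : trivBasis x () = tk (k := k) x 1 := by
  exact Module.Basis.singleton_apply Unit k ()

theorem trivBasis_coord (x : G) : (trivBasis x).coord () = utk (k := k) x := by
  change (Module.Basis.singleton Unit k).coord () = LinearMap.id
  ext
  simp

theorem comul_ab (a b : G → k) : comulₗ (ab a b) = il (tgt a) * ir (src b) := by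
  have h1 : (fun x => trivBasis x ()) = (trivSec 1 : Sec (triv : GRep k G)) :=
    funext fun x => trivBasis_apply x
  have h2 : (fun x => (trivBasis x).coord ()) = (trivDual 1 : DualSec (triv : GRep k G)) :=
    funext fun x => (trivBasis_coord x).trans (one_smul k (utk x)).symm
  rw [ab, comulₗ_mk triv trivBasis]
  simp only [Finset.univ_unique, Finset.sum_singleton]
  change il (mk triv (trivDual a) fun x => trivBasis x ()) *
    ir (mk triv (fun x => (trivBasis x).coord ()) (trivSec b)) = _
  rw [h1, h2]
  rfl

theorem comul_mul (a b : RepFun k G) : comulₗ (a * b) = comulₗ a * comulₗ b := by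
  induction a using RepFun.induction with
  | zero => simp
  | add a a' h h' => rw [add_mul, map_add, h, h', map_add, add_mul]
  | of E φ p =>
    induction b using RepFun.induction with
    | zero => simp
    | add a a' h h' => rw [mul_add, map_add, h, h', map_add, mul_add]
    | of F ψ q =>
      rw [mk_mul_mk, comulₗ_mk _ (tbasis E F), comulₗ_mk _ E.basis, comulₗ_mk _ F.basis,
        Finset.sum_mul_sum, Fintype.sum_prod_type]
      refine Finset.sum_congr rfl fun i _ => Finset.sum_congr rfl fun j _ => ?_
      rw [mul_mul_mul_comm, ← map_mul, ← map_mul, mk_mul_mk, mk_mul_mk, tbasis_coord]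
      simp only [tbasis_apply]
      rfl

/-- The comultiplication as an algebra map. -/
def comul : RepFun k G →ₐ[k] BalTensor (src (k := k) (G := G)) tgt :=
  AlgHom.ofLinearMap comulₗ
    (by rw [one_def]; refine (comul_ab 1 1).trans ?_; simp) comul_mul

theorem comul_mk {ι : Type*} [Fintype ι] (E : GRep k G) (b : ∀ x, Module.Basis ι k (E.E x))
    (φ : DualSec E) (p : Sec E) : comul (mk E φ p) =
      ∑ i, il (mk E φ fun x => b x i) * ir (mk E (fun x => (b x).coord i) p) := comulₗ_mk E b φ p

/-- The counit as a linear map, `ε(φ ⊗ p)(x) = φ(x)(p(x))`. -/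
def counitₗ : RepFun k G →ₗ[k] (G → k) :=
  lift (fun E => LinearMap.mk₂ k (fun φ p x => φ x (p x))
      (fun _ _ _ => rfl) (fun _ _ _ => rfl) (fun _ _ _ => by ext; simp) (fun _ _ _ => by ext; simp))
    (by intro E F f φ p; rfl)

theorem counitₗ_mk (E : GRep k G) (φ : DualSec E) (p : Sec E) :
    counitₗ (mk E φ p) = fun x => φ x (p x) := lift_mk _ _ E φ p

theorem counit_ab (a b : G → k) : counitₗ (ab a b) = a * b := by
  rw [ab, counitₗ_mk]
  ext x
  simp [trivDual, trivSec]

/-- The counit. -/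
def counit : RepFun k G →ₐ[k] (G → k) :=
  AlgHom.ofLinearMap counitₗ ((counit_ab 1 1).trans (one_mul 1)) (by
    intro a b
    induction a using RepFun.induction with
    | zero => simp
    | add a a' h h' => rw [add_mul, map_add, h, h', map_add, add_mul]
    | of E φ p =>
      induction b using RepFun.induction with
      | zero => simp
      | add a a' h h' => rw [mul_add, map_add, h, h', map_add, mul_add]
      | of F ψ q =>
        rw [mk_mul_mk, counitₗ_mk, counitₗ_mk, counitₗ_mk]
        ext x
        exact tdual_apply E F φ ψ x (p x) (q x))

theorem counit_mk (E : GRep k G) (φ : DualSec E) (p : Sec E) :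
    counit (mk E φ p) = fun x => φ x (p x) := counitₗ_mk E φ p

/-! The antipode -/

/-- A linear form on a fibre of `E` as an element of a fibre of the dual. -/
def dk (E : GRep k G) (x : G) : Module.Dual k (E.E x) →ₗ[k] (dual E).E x := LinearMap.id

/-- An element of a fibre of the dual as a linear form. -/
def udk (E : GRep k G) (x : G) : (dual E).E x →ₗ[k] Module.Dual k (E.E x) := LinearMap.id

@[simp] theorem udk_dk (E : GRep k G) (x : G) (a : Module.Dual k (E.E x)) :
    udk E x (dk E x a) = a := rfl

theorem dual_ext {E : GRep k G} {x : G} {a b : (dual E).E x}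
    (h : ∀ v, udk E x a v = udk E x b v) : a = b := LinearMap.ext h

@[simp] theorem udk_ρ {E : GRep k G} {x y : G} (g : x ⟶ y) (a : (dual E).E x) (v : E.E y) :
    udk E y ((dual E).ρ g a) v = udk E x a (E.ρ (Groupoid.inv g) v) := rfl

@[simp] theorem ρ_inv_ρ {E : GRep k G} {x y : G} (g : x ⟶ y) (v : E.E x) :
    E.ρ (Groupoid.inv g) (E.ρ g v) = v := by
  rw [← LinearMap.comp_apply, ← E.ρ_comp, Groupoid.comp_inv, E.ρ_id]
  rfl

/-- A section of `E^*`, seen as a section of the dual representation. -/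
def dsec (E : GRep k G) : DualSec E →ₗ[k] Sec (dual E) := LinearMap.id

/-- The image of a section of `E` under `E ≅ (E^*)^*`. -/
def ddual (E : GRep k G) : Sec E →ₗ[k] DualSec (dual E) where
  toFun p x := Module.Dual.eval k (E.E x) (p x) ∘ₗ udk E x
  map_add' p q := by ext; simp
  map_smul' c p := by ext; simp

@[simp] theorem udk_dsec (E : GRep k G) (φ : DualSec E) (x : G) : udk E x (dsec E φ x) = φ x := rfl

@[simp] theorem ddual_apply (E : GRep k G) (p : Sec E) (x : G) (a : (dual E).E x) :
    ddual E p x a = udk E x a (p x) := rfl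

/-- The transpose of a morphism. -/
def homDual {E F : GRep k G} (f : Hom E F) : Hom (dual F) (dual E) where
  app x := dk E x ∘ₗ (f.app x).dualMap ∘ₗ udk F x
  comm g := LinearMap.ext fun a => dual_ext fun v => by simp [Hom.comm_apply]

/-- The antipode as a linear map, `S(φ ⊗ p) = p̃ ⊗ φ`. -/
def antipodeₗ : RepFun k G →ₗ[k] RepFun k G :=
  lift (fun E => ((mkₗ (dual E)).compl₁₂ (ddual E) (dsec E)).flip)
    (by
      intro E F f φ p
      exact (mk_hom (homDual f) (ddual E p) (dsec F φ)).symm)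

theorem antipodeₗ_mk (E : GRep k G) (φ : DualSec E) (p : Sec E) :
    antipodeₗ (mk E φ p) = mk (dual E) (ddual E p) (dsec E φ) := lift_mk _ _ E φ p

/-- `E^* ⊗ F^* ≅ (E ⊗ F)^*` -/
def homDualTensor (E F : GRep k G) : Hom (tensor (dual E) (dual F)) (dual (tensor E F)) where
  app x := tlift (LinearMap.mk₂ k
    (fun a b => dk (tensor E F) x (tlift ((LinearMap.mul k k).compl₁₂ (udk E x a) (udk F x b))))
    (fun _ _ _ => dual_ext fun v => LinearMap.congr_fun (tensor_ext fun a b => by simp) v)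
    (fun _ _ _ => dual_ext fun v =>
      LinearMap.congr_fun (tensor_ext fun a b => by simp [mul_assoc]) v)
    (fun _ _ _ => dual_ext fun v => LinearMap.congr_fun (tensor_ext fun a b => by simp [mul_add]) v)
    (fun _ _ _ => dual_ext fun v =>
      LinearMap.congr_fun (tensor_ext fun a b => by simp [mul_left_comm]) v))
  comm g := tensor_ext fun a b => dual_ext fun v =>
    LinearMap.congr_fun (f := udk _ _ _) (g := udk _ _ _) (tensor_ext fun c d => by simp) v

/-- `I^* ≅ I` -/
def homDualTriv : Hom (dual (triv : GRep k G)) triv where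
  app x := tk x ∘ₗ (LinearMap.applyₗ (tk x 1)) ∘ₗ udk triv x
  comm _ := LinearMap.ext fun _ => rfl

/-- `E ≅ (E^*)^*` -/
def homBidual (E : GRep k G) : Hom E (dual (dual E)) where
  app x := dk (dual E) x ∘ₗ (udk E x).dualMap ∘ₗ Module.Dual.eval k (E.E x)
  comm g := LinearMap.ext fun a => dual_ext fun v => by simp

/-- The evaluation `E^* ⊗ E → I`. -/
def homEval (E : GRep k G) : Hom (tensor (dual E) E) triv where
  app x := tlift ((LinearMap.compr₂ (udk E x) (tk x)))
  comm g := tensor_ext fun a v => by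
    simp only [LinearMap.comp_apply, tlift_tmk, tensor_ρ, LinearMap.compr₂_apply, udk_ρ, ρ_inv_ρ]
    rfl

theorem antipode_ab (a b : G → k) : antipodeₗ (ab a b) = ab b a := by
  rw [ab, antipodeₗ_mk, ab]
  refine mk_eq homDualTriv (fun x => LinearMap.ext fun c => ?_) fun x => ?_
  · change udk triv x c (tk x (b x)) = b x * udk triv x c (tk x 1)
    rw [← smul_eq_mul, ← map_smul, ← map_smul, smul_eq_mul, mul_one]
  · change tk x (a x) = tk x (a x * 1)
    rw [mul_one]

/-- The antipode. -/
def antipode : RepFun k G →ₐ[k] RepFun k G :=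
  AlgHom.ofLinearMap antipodeₗ (antipode_ab 1 1) (by
    intro a b
    induction a using RepFun.induction with
    | zero => simp
    | add a a' h h' => rw [add_mul, map_add, h, h', map_add, add_mul]
    | of E φ p =>
      induction b using RepFun.induction with
      | zero => simp
      | add a a' h h' => rw [mul_add, map_add, h, h', map_add, mul_add]
      | of F ψ q =>
        rw [mk_mul_mk, antipodeₗ_mk, antipodeₗ_mk, antipodeₗ_mk, mk_mul_mk]
        refine (mk_eq (homDualTensor E F) (fun x => ?_) fun x => ?_).symm
        · exact tensor_ext fun a b => by simp [homDualTensor, tsec_apply]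
        · refine dual_ext fun v => ?_
          simp only [homDualTensor, tsec_apply, tlift_tmk]
          rfl)

theorem antipode_mk (E : GRep k G) (φ : DualSec E) (p : Sec E) :
    antipode (mk E φ p) = mk (dual E) (ddual E p) (dsec E φ) := antipodeₗ_mk E φ p

theorem antipode_antipode (a : RepFun k G) : antipode (antipode a) = a := by
  induction a using RepFun.induction with
  | zero => simp
  | add a a' h h' => rw [map_add, map_add, h, h']
  | of E φ p =>
    rw [antipode_mk, antipode_mk]
    refine (mk_eq (homBidual E) (fun x => ?_) fun x => ?_).symm
    · ext v
      simp [homBidual]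
    · exact dual_ext fun v => rfl

/-! The laws of a Hopf algebroid -/

theorem comul_tgt (a : G → k) : comul (tgt a) = il (tgt a) :=
  (comul_ab a 1).trans (by rw [map_one, map_one, mul_one])

theorem comul_src (a : G → k) : comul (src a) = ir (src a) :=
  (comul_ab 1 a).trans (by rw [map_one, map_one, one_mul])

theorem counit_tgt (a : G → k) : counit (tgt a) = a := (counit_ab a 1).trans (mul_one a)

theorem counit_src (a : G → k) : counit (src a) = a := (counit_ab 1 a).trans (one_mul a)

theorem antipode_tgt (a : G → k) : antipode (tgt a) = src a := antipode_ab a 1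

theorem antipode_src (a : G → k) : antipode (src a) = tgt a := antipode_ab 1 a

/-- The algebra map `x ⊗ y ↦ f(x) g(y)` on `R ⊗_A R`. -/
def blift {B : Type*} [CommRing B] [Algebra k B] (f g : RepFun k G →ₐ[k] B)
    (h : ∀ a : G → k, f (src a) = g (tgt a)) :
    BalTensor (src (k := k) (G := G)) tgt →ₐ[k] B :=
  BalTensor.lift (k := k) (A := G → k) (H := RepFun k G) f g h

theorem blift_tmul {B : Type*} [CommRing B] [Algebra k B] (f g : RepFun k G →ₐ[k] B)
    (h : ∀ a : G → k, f (src a) = g (tgt a)) (x y : RepFun k G) :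
    blift f g h (il x * ir y) = f x * g y :=
  BalTensor.lift_tmul (k := k) (A := G → k) (H := RepFun k G) f g h x y

theorem counit_left (h : ∀ a : G → k, (tgt.comp counit) (src a) = AlgHom.id k (RepFun k G) (tgt a))
    (z : RepFun k G) : blift (tgt.comp counit) (AlgHom.id k _) h (comul z) = z := by
  induction z using RepFun.induction with
  | zero => simp only [map_zero]
  | add a b ha hb => rw [map_add, map_add, ha, hb]
  | of E φ p =>
    rw [comul_mk E E.basis, map_sum]
    simp only [blift_tmul, AlgHom.comp_apply, AlgHom.id_apply, counit_mk, tgt_mul_mk,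
      ← mk_sum_left]
    congr 1
    funext x
    refine (E.basis x).ext fun i => ?_
    simp

theorem counit_right
    (h : ∀ a : G → k, AlgHom.id k (RepFun k G) (src a) = (src.comp counit) (tgt a))
    (z : RepFun k G) : blift (AlgHom.id k _) (src.comp counit) h (comul z) = z := by
  induction z using RepFun.induction with
  | zero => simp only [map_zero]
  | add a b ha hb => rw [map_add, map_add, ha, hb]
  | of E φ p =>
    rw [comul_mk E E.basis, map_sum]
    simp only [blift_tmul, AlgHom.comp_apply, AlgHom.id_apply, counit_mk,
      mul_comm _ (src _), src_mul_mk, ← mk_sum_right]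
    congr 1
    funext x
    simp [Module.Basis.sum_repr]

theorem antipode_left (h : ∀ a : G → k, antipode (src a) = AlgHom.id k (RepFun k G) (tgt a))
    (z : RepFun k G) : blift antipode (AlgHom.id k _) h (comul z) = src (counit z) := by
  induction z using RepFun.induction with
  | zero => simp only [map_zero]
  | add a b ha hb => simp only [map_add, ha, hb]
  | of E φ p =>
    rw [comul_mk E E.basis, map_sum]
    simp only [blift_tmul, AlgHom.id_apply, antipode_mk, mk_mul_mk, counit_mk, src_apply]
    rw [← mk_sum_left]
    refine mk_eq (homEval E) (fun x => tensor_ext fun a v => ?_) fun x => ?_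
    · simp only [Finset.sum_apply, LinearMap.sum_apply, tdual_apply, ddual_apply]
      change _ = (1 : k) * udk E x a v
      conv_rhs => rw [← (E.basis x).sum_repr v]
      simp only [map_sum, map_smul, smul_eq_mul, one_mul]
      exact Finset.sum_congr rfl fun i _ => mul_comm _ _
    · rfl

theorem antipode_right (h : ∀ a : G → k, AlgHom.id k (RepFun k G) (src a) = antipode (tgt a))
    (z : RepFun k G) : blift (AlgHom.id k _) antipode h (comul z) = tgt (counit z) := by
  rw [← antipode_src, ← antipode_left (fun a => by rw [antipode_src, AlgHom.id_apply])]
  induction comul z using BalTensor.induction with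
  | zero => simp only [map_zero]
  | add a b ha hb => simp only [map_add, ha, hb]
  | tmul x y =>
    refine (blift_tmul _ _ _ x y).trans
      (Eq.trans ?_ (congrArg antipode (blift_tmul _ _ _ x y)).symm)
    rw [map_mul, antipode_antipode]
    rfl

variable (k G) in
/-- `R ⊗_A R ⊗_A R` -/
abbrev R₃ : Type _ := BalTensor₃ (k := k) (A := G → k) (H := RepFun k G) src tgt

/-- `in₁` for `R ⊗_A R ⊗_A R`. -/
def j₁ : RepFun k G →ₐ[k] R₃ k G :=
  BalTensor₃.in₁ (k := k) (A := G → k) (H := RepFun k G) src tgt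

/-- `in₂` for `R ⊗_A R ⊗_A R`. -/
def j₂ : RepFun k G →ₐ[k] R₃ k G :=
  BalTensor₃.in₂ (k := k) (A := G → k) (H := RepFun k G) src tgt

/-- `in₃` for `R ⊗_A R ⊗_A R`. -/
def j₃ : RepFun k G →ₐ[k] R₃ k G :=
  BalTensor₃.in₃ (k := k) (A := G → k) (H := RepFun k G) src tgt

/-- `in₁₂` for `R ⊗_A R ⊗_A R`. -/
def j₁₂ : BalTensor (src (k := k) (G := G)) tgt →ₐ[k] R₃ k G :=
  BalTensor₃.in₁₂ (k := k) (A := G → k) (H := RepFun k G) src tgt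

/-- `in₂₃` for `R ⊗_A R ⊗_A R`. -/
def j₂₃ : BalTensor (src (k := k) (G := G)) tgt →ₐ[k] R₃ k G :=
  BalTensor₃.in₂₃ (k := k) (A := G → k) (H := RepFun k G) src tgt

theorem j₁₂_il (x : RepFun k G) : j₁₂ (il x) = j₁ x :=
  BalTensor₃.in₁₂_inl (k := k) (A := G → k) (H := RepFun k G) src tgt x

theorem j₁₂_ir (x : RepFun k G) : j₁₂ (ir x) = j₂ x :=
  BalTensor₃.in₁₂_inr (k := k) (A := G → k) (H := RepFun k G) src tgt x

theorem j₂₃_il (x : RepFun k G) : j₂₃ (il x) = j₂ x :=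
  BalTensor₃.in₂₃_inl (k := k) (A := G → k) (H := RepFun k G) src tgt x

theorem j₂₃_ir (x : RepFun k G) : j₂₃ (ir x) = j₃ x :=
  BalTensor₃.in₂₃_inr (k := k) (A := G → k) (H := RepFun k G) src tgt x

theorem comul_coassoc (h : ∀ a : G → k, (j₁₂.comp comul) (src a) = j₃ (tgt a))
    (h' : ∀ a : G → k, j₁ (src a) = (j₂₃.comp comul) (tgt a)) (z : RepFun k G) :
    blift (j₁₂.comp comul) j₃ h (comul z) = blift j₁ (j₂₃.comp comul) h' (comul z) := by
  induction z using RepFun.induction with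
  | zero => simp only [map_zero]
  | add a b ha hb => rw [map_add, map_add, map_add, ha, hb]
  | of E φ p =>
    rw [comul_mk E E.basis, map_sum, map_sum]
    simp only [blift_tmul, AlgHom.comp_apply]
    simp only [comul_mk E E.basis, map_sum, map_mul,
      j₁₂_il, j₁₂_ir, j₂₃_il, j₂₃_ir, Finset.sum_mul, Finset.mul_sum]
    rw [Finset.sum_comm]
    simp only [mul_assoc]

variable (k G) in
/-- The commutative Hopf algebroid `R_k(𝒢)` of representative functions over
`A = Fun(𝒢⁽⁰⁾, k)`. -/
def hopfAlgebroid : CommHopfAlgebroid k (G → k) (RepFun k G) where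
  s := src
  t := tgt
  Δ := comul
  ε := counit
  S := antipode
  Δ_t := comul_tgt
  Δ_s := comul_src
  ε_t := counit_tgt
  ε_s := counit_src
  coassoc := comul_coassoc _ _
  ε_left := counit_left _
  ε_right := counit_right _
  S_s := antipode_src
  S_t := antipode_tgt
  S_left := antipode_left _
  S_right := antipode_right _

end RepFun

end RepresentativeFunctions

end RepGroupoid

end

/-! An arrow `g : x ⟶ y` gives a character of `R_k(𝒢)`, the evaluation `φ ⊗ p ↦ φ(y)(ρ_g(p(x)))`; it
respects the relations in `J` because morphisms of representations are equivariant. The groupoid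
structure can be read off from these characters: `s(a)` and `t(a)` are sent to `a(x)` and `a(y)`,
the counit at `x` is evaluation at `𝟙 x`, precomposition with the antipode inverts the arrow, and
the comultiplication corresponds to composition of arrows. The map `α_{(u,X)}` is the family of
evaluations at the arrows `u(x)`, extended by zero off `X`, so its compatibility with products,
units and pseudo-inverses is checked one object at a time.

The substance is bijectivity. For a local biretraction `α` and an object `x`, the map `z ↦ α z x` is
multiplicative with values in a field, hence zero or a character. So it is enough to know all
characters (`exists_evalArrow_eq`), and this rests on the fact that an element of `R_k(𝒢)` whose
value at every arrow is zero is itself zero (`eq_zero_of_evalArrow`). Indeed, direct sums of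
representations turn any element into a single `φ ⊗ p`. If all its values vanish, then `φ` vanishes
on the subrepresentation generated by `p`, and moving the inclusion of this subrepresentation across
the tensor sign gives `φ ⊗ p = 0`. Transitivity makes the fibres of the subrepresentation
equidimensional. Now `R_k(𝒢)` is an algebra of functions on a finite set of arrows, and a character
that differs from every evaluation would be nonzero on a product of functions that vanishes at every
arrow.

Given the arrow at each `x` with `α 1 x ≠ 0`, (BRT1) forces its source to be `x` and (BRT2) forces
the targets to be distinct, so `α` comes from a local bisection. This bisection is unique because
matrix coefficients separate arrows: the functions `t(a)` detect the target, and the regular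
representation separates arrows with the same endpoints (`arrow_eq_of_evalArrow_eq`). -/

noncomputable section

namespace RepGroupoid

universe u v w

variable {k : Type w} [Field k] {G : Type u} [Groupoid.{v} G]

open GRep

/-! ### Direct sums, subrepresentations and the regular representation -/

namespace GRep

/-- The direct sum of two representations. -/
def prod (E F : GRep k G) : GRep k G where
  n := E.n + F.n
  E x := E.E x × F.E x
  finrank_eq x := by rw [Module.finrank_prod, E.finrank_eq, F.finrank_eq]
  ρ g := (E.ρ g).prodMap (F.ρ g)
  ρ_id x := by rw [E.ρ_id, F.ρ_id, LinearMap.prodMap_id]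
  ρ_comp h g := by rw [E.ρ_comp, F.ρ_comp, LinearMap.prodMap_comp]

/-- The projection `E ⊕ F → E`. -/
def homFst (E F : GRep k G) : Hom (prod E F) E where
  app x := LinearMap.fst k (E.E x) (F.E x)
  comm _ := rfl

/-- The projection `E ⊕ F → F`. -/
def homSnd (E F : GRep k G) : Hom (prod E F) F where
  app x := LinearMap.snd k (E.E x) (F.E x)
  comm _ := rfl

theorem ρ_ρ_inv {E : GRep k G} {x y : G} (g : x ⟶ y) (v : E.E y) :
    E.ρ g (E.ρ (Groupoid.inv g) v) = v := by
  rw [← LinearMap.comp_apply, ← E.ρ_comp, Groupoid.inv_comp, E.ρ_id]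
  rfl

theorem ρ_comp_apply (E : GRep k G) {x y z : G} (h : x ⟶ y) (g : y ⟶ z) (v : E.E x) :
    E.ρ (h ≫ g) v = E.ρ g (E.ρ h v) := by
  rw [E.ρ_comp]
  rfl

/-- The subrepresentation given by an invariant family of subspaces of the fibres of `E`. -/
def sub (E : GRep k G) [Nonempty G] (htrans : ∀ x y : G, Nonempty (x ⟶ y))
    (W : ∀ x, Submodule k (E.E x))
    (hW : ∀ {x y : G} (g : x ⟶ y), ∀ v ∈ W x, E.ρ g v ∈ W y) : GRep k G where
  n := Module.finrank k (W (Classical.arbitrary G))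
  E x := W x
  finrank_eq x := by
    -- All fibres need the same dimension: an arrow from `x` to the base object and its inverse
    -- carry the two subspaces onto each other.
    obtain ⟨g⟩ := htrans x (Classical.arbitrary G)
    refine LinearEquiv.finrank_eq (LinearEquiv.ofLinearMap ((E.ρ g).restrict (hW g))
      ((E.ρ (Groupoid.inv g)).restrict (hW (Groupoid.inv g))) ?_ ?_)
    · ext v
      exact ρ_ρ_inv g v.1
    · ext v
      exact RepFun.ρ_inv_ρ g v.1
  ρ g := (E.ρ g).restrict (hW g)
  ρ_id x := by
    ext v
    simp [E.ρ_id]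
  ρ_comp h g := by
    ext v
    simp [E.ρ_comp]

/-- The inclusion of a subrepresentation. -/
def homSub (E : GRep k G) [Nonempty G] (htrans : ∀ x y : G, Nonempty (x ⟶ y))
    (W : ∀ x, Submodule k (E.E x))
    (hW : ∀ {x y : G} (g : x ⟶ y), ∀ v ∈ W x, E.ρ g v ∈ W y) : Hom (E.sub htrans W hW) E where
  app x := (W x).subtype
  comm _ := rfl

/-- The representation on the functions on the arrows with source `x₀`, the fibre at `y` being
indexed by a numbering of the arrows `x₀ ⟶ y`. -/
def regular (k : Type w) [Field k] {x₀ : G} {n : ℕ} (e : ∀ y, (x₀ ⟶ y) ≃ Fin n) : GRep k G where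
  n := n
  -- Coordinates are indexed by `Fin n` because a fibre must lie in the universe of `k`; functions
  -- on the arrows themselves need not.
  E _ := Fin n → k
  finrank_eq _ := Module.finrank_fin_fun k
  -- Under the numberings this is left translation, `(ρ_g f)(a) = f(g⁻¹ a)`.
  ρ {y z} g := LinearMap.funLeft k k fun i => e y ((e z).symm i ≫ Groupoid.inv g)
  ρ_id x := by
    ext
    simp [LinearMap.funLeft]
  ρ_comp h g := by
    ext
    simp [LinearMap.funLeft]

end GRep

/-! ### Evaluation at arrows -/

namespace RepFun

/-- The evaluation `φ ⊗ p ↦ φ(t(g))(ρ_g(p(s(g))))` of representative functions at an arrow `g`, as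
a linear map. -/
def evalArrowₗ {x y : G} (g : x ⟶ y) : RepFun k G →ₗ[k] k :=
  lift (fun E => LinearMap.mk₂ k (fun φ p => φ y (E.ρ g (p x)))
      (fun _ _ _ => rfl) (fun _ _ _ => rfl) (fun _ _ _ => by simp) (fun _ _ _ => by simp))
    (by
      intro E F f φ p
      simp [Hom.push, Hom.pull, Hom.comm_apply])

theorem evalArrowₗ_mk {x y : G} (g : x ⟶ y) (E : GRep k G) (φ : DualSec E) (p : Sec E) :
    evalArrowₗ g (mk E φ p) = φ y (E.ρ g (p x)) := lift_mk _ _ E φ p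

theorem evalArrowₗ_ab {x y : G} (g : x ⟶ y) (a b : G → k) :
    evalArrowₗ g (ab a b) = a y * b x := by
  rw [ab, evalArrowₗ_mk]
  rfl

/-- The evaluation of representative functions at an arrow. -/
def evalArrow {x y : G} (g : x ⟶ y) : RepFun k G →ₐ[k] k :=
  AlgHom.ofLinearMap (evalArrowₗ g) ((evalArrowₗ_ab g 1 1).trans (one_mul 1)) (by
    intro a b
    induction a using RepFun.induction with
    | zero => simp
    | add a a' h h' => rw [add_mul, map_add, h, h', map_add, add_mul]
    | of E φ p =>
      induction b using RepFun.induction with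
      | zero => simp
      | add a a' h h' => rw [mul_add, map_add, h, h', map_add, mul_add]
      | of F ψ q =>
        rw [mk_mul_mk, evalArrowₗ_mk, evalArrowₗ_mk, evalArrowₗ_mk, tsec_apply, tensor_ρ,
          tdual_apply])

theorem evalArrow_mk {x y : G} (g : x ⟶ y) (E : GRep k G) (φ : DualSec E) (p : Sec E) :
    evalArrow g (mk E φ p) = φ y (E.ρ g (p x)) := evalArrowₗ_mk g E φ p

theorem evalArrow_src {x y : G} (g : x ⟶ y) (a : G → k) : evalArrow g (src a) = a x :=
  (evalArrowₗ_ab g 1 a).trans (one_mul _)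

theorem evalArrow_tgt {x y : G} (g : x ⟶ y) (a : G → k) : evalArrow g (tgt a) = a y :=
  (evalArrowₗ_ab g a 1).trans (mul_one _)

theorem evalArrow_id (x : G) (h : RepFun k G) : evalArrow (𝟙 x) h = counit h x := by
  induction h using RepFun.induction with
  | zero => simp
  | add a b ha hb => rw [map_add, ha, hb, map_add, Pi.add_apply]
  | of E φ p =>
    rw [evalArrow_mk, counit_mk, E.ρ_id]
    rfl

/-- The dual representation acts through the transpose of `ρ_{g⁻¹}`, so both sides pair `φ(x)` with
`ρ_{g⁻¹}(p(y))`. -/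
theorem evalArrow_antipode {x y : G} (g : x ⟶ y) (h : RepFun k G) :
    evalArrow g (antipode h) = evalArrow (Groupoid.inv g) h := by
  induction h using RepFun.induction with
  | zero => simp
  | add a b ha hb => rw [map_add, map_add, ha, hb, map_add]
  | of E φ p => rw [antipode_mk, evalArrow_mk, evalArrow_mk, ddual_apply, udk_ρ, udk_dsec]

/-! ### Faithfulness, characters and separation of arrows -/

/-- Over `E ⊕ F` the sum `φ ⊗ p + ψ ⊗ q` becomes the single term `(φ, ψ) ⊗ (p, q)`. Vanishing then
only has to be tested on one representation. -/
theorem exists_eq_mk (z : RepFun k G) :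
    ∃ (E : GRep k G) (φ : DualSec E) (p : Sec E), z = mk E φ p := by
  induction z using RepFun.induction with
  | of E φ p => exact ⟨E, φ, p, rfl⟩
  | zero => exact ⟨triv, 0, 0, ((mkₗ triv 0).map_zero).symm⟩
  | add z w hz hw =>
    obtain ⟨E, φ, p, rfl⟩ := hz
    obtain ⟨F, ψ, q, rfl⟩ := hw
    let r : Sec (GRep.prod E F) := fun x => (p x, q x)
    refine ⟨GRep.prod E F, (homFst E F).pull φ + (homSnd E F).pull ψ, r, ?_⟩
    -- The two projections, moved across the tensor sign, send `(p, q)` to `p` and to `q`.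
    rw [mk_add_left, ← mk_hom, ← mk_hom]
    rfl

/-- A representative function on a transitive groupoid is determined by its values. -/
theorem eq_zero_of_evalArrow (htrans : ∀ x y : G, Nonempty (x ⟶ y)) (z : RepFun k G)
    (hz : ∀ (x y : G) (g : x ⟶ y), evalArrow g z = 0) : z = 0 := by
  obtain ⟨E, φ, p, rfl⟩ := exists_eq_mk z
  simp only [evalArrow_mk] at hz
  -- The dimension of a subrepresentation is read off at a base object, so the empty groupoid is
  -- treated apart.
  rcases isEmpty_or_nonempty G with hG | hG
  · rw [Subsingleton.elim φ 0]
    exact (mkₗ E).map_zero₂ p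
  -- The subrepresentation generated by the section `p`. By hypothesis `φ` vanishes on its
  -- generators.
  let W : ∀ x, Submodule k (E.E x) := fun x =>
    Submodule.span k (Set.range fun q : Σ y, (y ⟶ x) => E.ρ q.2 (p q.1))
  have hW : ∀ {x y : G} (g : x ⟶ y), ∀ v ∈ W x, E.ρ g v ∈ W y := by
    intro x y g v hv
    induction hv using Submodule.span_induction with
    | zero => rw [map_zero]; exact zero_mem _
    | add a b _ _ ha hb => rw [map_add]; exact add_mem ha hb
    | smul c a _ ha => rw [map_smul]; exact Submodule.smul_mem _ c ha
    | mem v hv =>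
      obtain ⟨⟨z, f⟩, rfl⟩ := hv
      exact Submodule.subset_span ⟨⟨z, f ≫ g⟩, E.ρ_comp_apply f g _⟩
  have hp : ∀ x, p x ∈ W x := fun x => Submodule.subset_span ⟨⟨x, 𝟙 x⟩, by simp [E.ρ_id]⟩
  have hφ : (homSub E htrans W hW).pull φ = 0 := by
    funext x
    refine LinearMap.ext fun v => ?_
    obtain ⟨v, hv⟩ := v
    change φ x v = 0
    induction hv using Submodule.span_induction with
    | zero => exact map_zero _
    | add a b _ _ ha hb => rw [map_add, ha, hb, add_zero]
    | smul c a _ ha => rw [map_smul, ha, smul_zero]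
    | mem v hv =>
      obtain ⟨⟨y, f⟩, rfl⟩ := hv
      exact hz y x f
  -- With `ι : W → E` the inclusion, `φ ⊗ p = φ ⊗ ιp = φι ⊗ p`, and `φι = 0`.
  have := mk_hom (homSub E htrans W hW) φ fun x => ⟨p x, hp x⟩
  rw [hφ] at this
  exact this.trans ((mkₗ _).map_zero₂ _)

/-- Every character of the algebra of representative functions of a finite transitive groupoid is
the evaluation at an arrow. -/
theorem exists_evalArrow_eq [Finite G] [∀ x y : G, Finite (x ⟶ y)]
    (htrans : ∀ x y : G, Nonempty (x ⟶ y)) (χ : RepFun k G →ₐ[k] k) :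
    ∃ (x y : G) (g : x ⟶ y), χ = evalArrow g := by
  by_contra! hne
  have := Fintype.ofFinite (Σ x y : G, (x ⟶ y))
  have key : ∀ q : Σ x y : G, (x ⟶ y), ∃ h, χ h ≠ evalArrow q.2.2 h := fun q => by
    by_contra! h
    exact hne q.1 q.2.1 q.2.2 (AlgHom.ext h)
  choose h hh using key
  -- The factor with index `q` vanishes at the arrow `q`, so the product vanishes at every arrow;
  -- yet `χ` sends each factor to a nonzero scalar.
  have h0 : ∏ q, (h q - algebraMap k _ (evalArrow q.2.2 (h q))) = 0 := by
    refine eq_zero_of_evalArrow htrans _ fun x y g => ?_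
    rw [map_prod]
    refine Finset.prod_eq_zero (Finset.mem_univ ⟨x, y, g⟩) ?_
    rw [map_sub, AlgHom.commutes]
    exact sub_self _
  have h1 := congrArg χ h0
  rw [map_prod, map_zero, Finset.prod_eq_zero_iff] at h1
  obtain ⟨q, -, hq⟩ := h1
  rw [map_sub, AlgHom.commutes] at hq
  exact hh q (sub_eq_zero.1 hq)

/-- Representative functions of a finite transitive groupoid separate the arrows. -/
theorem arrow_eq_of_evalArrow_eq [∀ x y : G, Finite (x ⟶ y)]
    (htrans : ∀ x y : G, Nonempty (x ⟶ y)) {x : G} {q r : Σ y : G, (x ⟶ y)}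
    (h : ∀ z : RepFun k G, evalArrow q.2 z = evalArrow r.2 z) : q = r := by
  classical
  obtain ⟨y, g⟩ := q
  obtain ⟨y', g'⟩ := r
  -- The function `t(δ_{y'})` has value `1` exactly at the arrows with target `y'`.
  obtain rfl : y' = y := by
    have := h (tgt (Pi.single y' 1))
    rw [evalArrow_tgt, evalArrow_tgt, Pi.single_eq_same] at this
    by_contra hne
    rw [Pi.single_eq_of_ne (Ne.symm hne)] at this
    exact zero_ne_one this
  -- Composition with an arrow `z ⟶ x` identifies `x ⟶ z` with `x ⟶ x`, so all these sets have
  -- numberings of one common length.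
  have he : ∀ z, Nonempty ((x ⟶ z) ≃ Fin (Nat.card (x ⟶ x))) := fun z => by
    obtain ⟨f⟩ := htrans z x
    exact ⟨(Equiv.mk (fun a => a ≫ f) (fun a => a ≫ Groupoid.inv f) (fun a => by simp)
      (fun a => by simp)).trans (Finite.equivFin _)⟩
  let e := fun z => (he z).some
  -- Take the coordinate at `g'` and the delta function at `𝟙 x`; only the fibres over `y'` and `x`
  -- matter. The matrix coefficient at an arrow `f : x ⟶ y'` is `1` if `f⁻¹ g' = 𝟙 x` and `0`
  -- otherwise, hence the indicator of `g'`.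
  let φ : DualSec (regular k e) := fun _ => LinearMap.proj (e y' g')
  let p : Sec (regular k e) := fun _ => (Pi.single (e x (𝟙 x)) 1 : Fin (Nat.card (x ⟶ x)) → k)
  have h1 := (evalArrow_mk g _ φ p).symm.trans ((h (mk _ φ p)).trans (evalArrow_mk g' _ φ p))
  change (Pi.single (e x (𝟙 x)) 1 : Fin (Nat.card (x ⟶ x)) → k)
      (e x ((e y').symm (e y' g') ≫ Groupoid.inv g)) =
    (Pi.single (e x (𝟙 x)) 1 : Fin (Nat.card (x ⟶ x)) → k)
      (e x ((e y').symm (e y' g') ≫ Groupoid.inv g')) at h1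
  rw [Equiv.symm_apply_apply, Groupoid.comp_inv, Pi.single_eq_same] at h1
  by_cases hg : g' ≫ Groupoid.inv g = 𝟙 x
  · have := congrArg (· ≫ g) hg
    simp only [Category.assoc, Groupoid.inv_comp, Category.comp_id, Category.id_comp] at this
    rw [this]
  · rw [Pi.single_eq_of_ne fun h2 => hg ((e x).injective h2)] at h1
    exact absurd h1 zero_ne_one

end RepFun

/-! ### Uniqueness of the element in (BRT2) -/

section

variable {k A H : Type*} [Field k] [CommRing A] [Algebra k A] [CommRing H] [Algebra k H]
  {ℋ : CommHopfAlgebroid k A H}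

/-- The element `e^α` is the only one with the properties in (BRT2). -/
theorem Biretraction.e_eq (α : Biretraction ℋ) {e : A} (h1 : α (ℋ.t e) = α 1)
    (h2 : Set.InjOn (fun a => α (ℋ.t a)) (Ideal.span {e} : Ideal A)) : α.e = e := by
  -- The product `e e^α` lies in both ideals and has the same image `α 1` as each factor;
  -- injectivity on each ideal makes it equal to both.
  have h3 : α (ℋ.t (e * α.e)) = α 1 := by rw [map_mul, α.mul', h1, α.t_e, α.mul_one']
  have h4 : e * α.e = e :=
    h2 (Ideal.mul_mem_right _ _ (Ideal.subset_span rfl)) (Ideal.subset_span rfl) (h3.trans h1.symm)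
  have h5 : e * α.e = α.e := α.inj (Ideal.mul_mem_left _ _ α.e_mem) α.e_mem (h3.trans α.t_e.symm)
  exact h5.symm.trans h4

end

open RepFun

/-! ### From local bisections to local biretractions -/

namespace LocalBisection

open Classical in
/-- The linear map `α_{(u,X)}` underlying the local biretraction of a local bisection. -/
def evalMap (k : Type w) [Field k] (b : LocalBisection G) : RepFun k G →ₙₐ[k] (G → k) where
  toFun h x := if hx : x ∈ b.dom then evalArrow (b.u x hx).2 h else 0
  map_smul' c h := by
    funext x
    by_cases hx : x ∈ b.dom <;> simp [hx]
  map_zero' := by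
    funext x
    by_cases hx : x ∈ b.dom <;> simp [hx]
  map_add' h h' := by
    funext x
    by_cases hx : x ∈ b.dom <;> simp [hx]
  map_mul' h h' := by
    funext x
    by_cases hx : x ∈ b.dom <;> simp [hx]

theorem evalMap_of_mem (b : LocalBisection G) {x : G} (hx : x ∈ b.dom) (h : RepFun k G) :
    b.evalMap k h x = evalArrow (b.u x hx).2 h := dif_pos hx

theorem evalMap_of_notMem (b : LocalBisection G) {x : G} (hx : x ∉ b.dom) (h : RepFun k G) :
    b.evalMap k h x = 0 := dif_neg hx

variable (k) in
open Classical in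
/-- The indicator function of the set of targets `t(u(X))`. -/
def targetInd (b : LocalBisection G) : G → k := fun y => if y ∈ b.inverse.dom then 1 else 0

theorem u_mem_inverse_dom (b : LocalBisection G) {x : G} (hx : x ∈ b.dom) :
    (b.u x hx).1 ∈ b.inverse.dom := ⟨x, hx, rfl⟩

theorem evalMap_tgt_targetInd (b : LocalBisection G) :
    b.evalMap k (tgt (b.targetInd k)) = b.evalMap k 1 := by
  funext x
  by_cases hx : x ∈ b.dom
  · rw [b.evalMap_of_mem hx, b.evalMap_of_mem hx, evalArrow_tgt, map_one]
    exact if_pos (b.u_mem_inverse_dom hx)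
  · rw [b.evalMap_of_notMem hx, b.evalMap_of_notMem hx]

theorem mem_span_targetInd (b : LocalBisection G) {a : G → k} :
    a ∈ Ideal.span {b.targetInd k} ↔ ∀ y, y ∉ b.inverse.dom → a y = 0 := by
  rw [Ideal.mem_span_singleton']
  constructor
  · rintro ⟨c, rfl⟩ y hy
    rw [Pi.mul_apply, targetInd, if_neg hy, mul_zero]
  · intro h
    refine ⟨a, funext fun y => ?_⟩
    by_cases hy : y ∈ b.inverse.dom
    · rw [Pi.mul_apply, targetInd, if_pos hy, mul_one]
    · rw [Pi.mul_apply, h y hy, zero_mul]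

/-- The value of `α(t(a))` at `x ∈ X` is `a(t(u(x)))`, which recovers every function supported on
`t(u(X))`. Used both for (BRT2) and to identify `e^α`. -/
theorem evalMap_tgt_injOn (b : LocalBisection G) :
    Set.InjOn (fun a => b.evalMap k (tgt (k := k) a))
      (Ideal.span {b.targetInd k} : Ideal (G → k)) := by
  intro a ha c hc h
  funext y
  by_cases hy : y ∈ b.inverse.dom
  · obtain ⟨x, hx, rfl⟩ := hy
    have := congrFun h x
    simpa only [b.evalMap_of_mem hx, evalArrow_tgt] using this
  · rw [b.mem_span_targetInd.1 ha y hy, b.mem_span_targetInd.1 hc y hy]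

/-- The local biretraction `α_{(u,X)}` of a local bisection `(u, X)`. -/
def toBiretraction (k : Type w) [Field k] (b : LocalBisection G) :
    Biretraction (hopfAlgebroid k G) where
  toMap := b.evalMap k
  brt1 a := by
    change b.evalMap k (src a) = a * b.evalMap k 1
    funext x
    by_cases hx : x ∈ b.dom
    · rw [Pi.mul_apply, b.evalMap_of_mem hx, b.evalMap_of_mem hx, evalArrow_src, map_one, mul_one]
    · rw [Pi.mul_apply, b.evalMap_of_notMem hx, b.evalMap_of_notMem hx, mul_zero]
  brt2 := by
    change ∃ e : G → k, b.evalMap k (tgt e) = b.evalMap k 1 ∧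
      Set.BijOn (fun a => b.evalMap k (tgt a)) (Ideal.span {e} : Ideal (G → k))
        (Ideal.span {b.evalMap k (1 : RepFun k G)} : Ideal (G → k))
    have mul1 : ∀ z : RepFun k G, b.evalMap k z * b.evalMap k 1 = b.evalMap k z := fun z => by
      rw [← map_mul, mul_one]
    refine ⟨b.targetInd k, b.evalMap_tgt_targetInd, fun a _ => ?_, b.evalMap_tgt_injOn,
      fun a ha => ?_⟩
    · exact Ideal.mem_span_singleton'.2 ⟨_, mul1 _⟩
    · obtain ⟨c, rfl⟩ := Ideal.mem_span_singleton'.1 ha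
      -- The preimage takes the value `c(x)` at `t(u(x))` and zero off `t(u(X))`; the inverse
      -- bisection produces exactly this function.
      refine ⟨b.inverse.evalMap k (tgt c),
        b.mem_span_targetInd.2 fun y hy => b.inverse.evalMap_of_notMem hy _, funext fun x => ?_⟩
      by_cases hx : x ∈ b.dom
      · simp only [b.evalMap_of_mem hx, evalArrow_tgt, Pi.mul_apply, map_one, mul_one]
        rw [b.inverse.evalMap_of_mem (b.u_mem_inverse_dom hx), evalArrow_tgt, b.inverse_u x hx]
      · simp only [b.evalMap_of_notMem hx, Pi.mul_apply, mul_zero]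

theorem toBiretraction_apply (b : LocalBisection G) (h : RepFun k G) :
    b.toBiretraction k h = b.evalMap k h := rfl

/-- The element `e^α` is only chosen from an existence statement; its uniqueness makes it
computable, as the pseudo-inverse requires. -/
theorem toBiretraction_e (b : LocalBisection G) : (b.toBiretraction k).e = b.targetInd k :=
  (b.toBiretraction k).e_eq b.evalMap_tgt_targetInd b.evalMap_tgt_injOn

/-- At an object `x` with both arrows defined, writing `u`, `v` for the arrows given by `b`, `c`,
the convolution is `∑ i, φ(ρ_u eᵢ) eᵢ^*(ρ_v p(x))`. This is the expansion of `φ(ρ_u ρ_v p(x))` in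
the basis of the intermediate fibre. -/
theorem toBiretraction_mul (b c : LocalBisection G) :
    (b * c).toBiretraction k = b.toBiretraction k * c.toBiretraction k := by
  refine Biretraction.ext' fun h => ?_
  induction h using RepFun.induction with
  | zero => rw [Biretraction.zero', Biretraction.zero']
  | add x y hx hy => rw [Biretraction.add', hx, hy, Biretraction.add']
  | of E φ p =>
    let F : BalTensor (src (k := k) (G := G)) tgt →ₗ[k] (G → k) :=
      Biretraction.convLin (k := k) (A := G → k) (H := RepFun k G)
        (ℋ := hopfAlgebroid k G) (b.toBiretraction k) (c.toBiretraction k)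
    have hF : ∀ y z : RepFun k G,
        F (il y * ir z) = c.evalMap k (tgt (b.evalMap k y)) * c.evalMap k z :=
      Biretraction.convLin_apply (b.toBiretraction k) (c.toBiretraction k)
    refine Eq.trans ?_ (Biretraction.mul_apply _ _ _).symm
    change (b * c).evalMap k (RepFun.mk E φ p) = F (comul (RepFun.mk E φ p))
    rw [comul_mk E E.basis, map_sum]
    simp only [hF]
    funext x
    rw [Finset.sum_apply]
    simp only [Pi.mul_apply]
    by_cases hx : x ∈ c.dom
    · simp only [c.evalMap_of_mem hx, evalArrow_tgt]
      by_cases hy : (c.u x hx).1 ∈ b.dom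
      · have hm : x ∈ (b * c).dom := ⟨hx, hy⟩
        simp only [b.evalMap_of_mem hy, (b * c).evalMap_of_mem hm, evalArrow_mk]
        change φ _ (E.ρ ((c.u x hx).2 ≫ (b.u _ hy).2) (p x)) = _
        rw [ρ_comp_apply]
        -- The basis is the one over the target of the first arrow, where the two arrows meet.
        conv_lhs => rw [← (E.basis (c.u x hx).1).sum_repr (E.ρ (c.u x hx).2 (p x))]
        simp only [map_sum, map_smul, smul_eq_mul]
        exact Finset.sum_congr rfl fun i _ => mul_comm _ _
      · have hm : x ∉ (b * c).dom := fun h => hy h.2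
        simp only [b.evalMap_of_notMem hy, (b * c).evalMap_of_notMem hm, zero_mul,
          Finset.sum_const_zero]
    · have hm : x ∉ (b * c).dom := fun h => hx h.1
      simp only [c.evalMap_of_notMem hx, (b * c).evalMap_of_notMem hm, zero_mul,
          Finset.sum_const_zero]

theorem toBiretraction_one : (1 : LocalBisection G).toBiretraction k = 1 := by
  refine Biretraction.ext' fun h => funext fun x => ?_
  refine ((1 : LocalBisection G).evalMap_of_mem (Set.mem_univ x) h).trans ?_
  exact evalArrow_id x h

/-- The value of `α^*` at `h` is the only element of `A e^α` that `α ∘ t` sends to `α(S(h))`. The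
candidate has the right support, and its value at `t(u(x))` is that of `h` at `u(x)⁻¹`, hence that
of `S(h)` at `u(x)`. -/
theorem toBiretraction_inverse (b : LocalBisection G) :
    b.inverse.toBiretraction k = (b.toBiretraction k).pinv := by
  refine Biretraction.ext' fun h => ((b.toBiretraction k).tinv_eq ?_ ?_).symm
  · rw [toBiretraction_e]
    funext y
    by_cases hy : y ∈ b.inverse.dom
    · rw [Pi.mul_apply, targetInd, if_pos hy, mul_one]
    · rw [Pi.mul_apply, toBiretraction_apply, b.inverse.evalMap_of_notMem hy, zero_mul]
  · change b.evalMap k (tgt (b.inverse.evalMap k h)) = b.evalMap k (antipode h)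
    funext x
    by_cases hx : x ∈ b.dom
    · rw [b.evalMap_of_mem hx, b.evalMap_of_mem hx, evalArrow_tgt, evalArrow_antipode,
        b.inverse.evalMap_of_mem (b.u_mem_inverse_dom hx), b.inverse_u x hx]
    · rw [b.evalMap_of_notMem hx, b.evalMap_of_notMem hx]

theorem mem_dom_iff_evalMap_one (b : LocalBisection G) (x : G) :
    x ∈ b.dom ↔ b.evalMap k (1 : RepFun k G) x ≠ 0 := by
  by_cases hx : x ∈ b.dom
  · simp [b.evalMap_of_mem hx, hx]
  · simp [b.evalMap_of_notMem hx, hx]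

/-- The domain is recovered as the support of `α 1`, and each arrow from its evaluation character.
-/
theorem toBiretraction_injective [∀ x y : G, Finite (x ⟶ y)]
    (htrans : ∀ x y : G, Nonempty (x ⟶ y)) :
    Function.Injective (toBiretraction k : LocalBisection G → _) := by
  intro b c h
  have he : ∀ (z : RepFun k G) x, b.evalMap k z x = c.evalMap k z x := fun z x =>
    congrFun (congrArg (fun α : Biretraction (hopfAlgebroid k G) => α z) h) x
  refine eq_of (fun x => ?_) fun x hb hc => ?_
  · rw [b.mem_dom_iff_evalMap_one (k := k), c.mem_dom_iff_evalMap_one (k := k), he]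
  · refine arrow_eq_of_evalArrow_eq (k := k) htrans fun z => ?_
    rw [← b.evalMap_of_mem hb, ← c.evalMap_of_mem hc, he]

end LocalBisection

/-! ### Every local biretraction comes from a local bisection -/

namespace Biretraction

/-- The value `α 1 x` is an idempotent of the field `k`, so when nonzero it is `1` and `z ↦ α z x`
is a unital character, hence an evaluation at some arrow. -/
theorem exists_evalArrow [Finite G] [∀ x y : G, Finite (x ⟶ y)]
    (htrans : ∀ x y : G, Nonempty (x ⟶ y)) (α : Biretraction (hopfAlgebroid k G)) {x : G}
    (hx : α 1 x ≠ 0) : ∃ q : Σ y : G, (x ⟶ y), ∀ z, α z x = evalArrow q.2 z := by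
  classical
  have h1 : α 1 x = 1 := by
    have := congrFun (α.mul_one' 1) x
    exact mul_right_cancel₀ hx (this.trans (one_mul _).symm)
  let χ : RepFun k G →ₐ[k] k := AlgHom.ofLinearMap
    { toFun := fun z => α z x
      map_add' := fun z w => congrFun (α.add' z w) x
      map_smul' := fun c z => congrFun (α.smul' c z) x } h1 fun z w => congrFun (α.mul' z w) x
  obtain ⟨x', y, g, hχ⟩ := exists_evalArrow_eq htrans χ
  have hg : ∀ z, α z x = evalArrow g z := fun z => DFunLike.congr_fun hχ z
  -- By (BRT1) the character sends `s(δ_x)` to `1`, while evaluation at an arrow with source `x'`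
  -- gives `δ_x(x')`.
  obtain rfl : x = x' := by
    have h2 := (hg (src (Pi.single x 1))).symm.trans (congrFun (α.s' (Pi.single x 1)) x)
    rw [evalArrow_src, Pi.mul_apply, h1, Pi.single_eq_same, mul_one] at h2
    by_contra hne
    rw [Pi.single_eq_of_ne (Ne.symm hne)] at h2
    exact zero_ne_one h2
  exact ⟨⟨y, g⟩, hg⟩

theorem exists_toBiretraction_eq [Finite G] [∀ x y : G, Finite (x ⟶ y)]
    (htrans : ∀ x y : G, Nonempty (x ⟶ y)) (α : Biretraction (hopfAlgebroid k G)) :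
    ∃ b : LocalBisection G, b.toBiretraction k = α := by
  classical
  choose u hu using fun (x : G) (hx : α 1 x ≠ 0) => α.exists_evalArrow htrans hx
  refine ⟨⟨{x | α 1 x ≠ 0}, u, fun x hx y hy h => ?_⟩, ?_⟩
  · obtain ⟨a, -, ha⟩ := α.bijOn.surjOn
      (Ideal.mul_mem_left (Ideal.span {α 1}) (Pi.single x 1) (Ideal.subset_span rfl))
    have hx1 := congrFun ha x
    have hy1 := congrFun ha y
    have ex : α (tgt a) x = a (u x hx).1 := (hu x hx _).trans (evalArrow_tgt _ a)
    have ey : α (tgt a) y = a (u y hy).1 := (hu y hy _).trans (evalArrow_tgt _ a)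
    by_contra hne
    rw [Pi.mul_apply, Pi.single_eq_same, one_mul] at hx1
    rw [Pi.mul_apply, Pi.single_eq_of_ne (Ne.symm hne), zero_mul] at hy1
    exact hx (hx1.symm.trans (ex.trans ((congrArg a h).trans (ey.symm.trans hy1))))
  · refine Biretraction.ext' fun z => funext fun x => ?_
    by_cases hx : α 1 x ≠ 0
    · exact (LocalBisection.evalMap_of_mem _ hx z).trans (hu x hx z).symm
    · refine (LocalBisection.evalMap_of_notMem _ hx z).trans ?_
      -- Off the domain `α z x = α z x · α 1 x = 0`.
      rw [← α.mul_one' z, Pi.mul_apply, not_not.1 hx, mul_zero]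

end Biretraction

end RepGroupoid

end

/-! ### The isomorphism of regular monoids -/

theorem mainTheorem7 {k : Type*} [Field k] [CharZero k] {G : Type*} [Groupoid G] [Finite G]
    [∀ x y : G, Finite (x ⟶ y)] (htrans : ∀ x y : G, Nonempty (x ⟶ y)) :
    ∃ Φ : RepGroupoid.RegularMonoidIso (RepGroupoid.LocalBisection G)
        (RepGroupoid.Biretraction (RepGroupoid.RepFun.hopfAlgebroid k G)),
      ∀ (b : RepGroupoid.LocalBisection G) (E : RepGroupoid.GRep k G)
        (φ : ∀ x : G, Module.Dual k (E.E x)) (p : ∀ x : G, E.E x) (x : G),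
        (∀ hx : x ∈ b.dom, (Φ.toEquiv b).toMap (RepGroupoid.RepFun.mk E φ p) x =
          φ (b.u x hx).1 (E.ρ (b.u x hx).2 (p x))) ∧
        (x ∉ b.dom → (Φ.toEquiv b).toMap (RepGroupoid.RepFun.mk E φ p) x = 0) :=
  ⟨{ toEquiv := Equiv.ofBijective (RepGroupoid.LocalBisection.toBiretraction k)
        ⟨RepGroupoid.LocalBisection.toBiretraction_injective htrans,
          RepGroupoid.Biretraction.exists_toBiretraction_eq htrans⟩
     map_mul := RepGroupoid.LocalBisection.toBiretraction_mul
     map_one := RepGroupoid.LocalBisection.toBiretraction_one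
     map_pinv := RepGroupoid.LocalBisection.toBiretraction_inverse },
    fun b E φ p _ => ⟨fun hx => (b.evalMap_of_mem hx _).trans
      (RepGroupoid.RepFun.evalArrow_mk _ E φ p), fun hx => b.evalMap_of_notMem hx _⟩⟩
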